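/- For an algebraic number $\alpha\in\mathbb C$ of degree $d$ over $\mathbb Q$ with minimal polynomial $a\prod_{i=1}^{d}(X-\alpha^{(i)})$ over $\mathbb Z$ (the primitive integer polynomial vanishing at $\alpha$, with complex roots $\alpha^{(i)}$), let $$h(\alpha)=\frac1d\Big(\log|a|+\sum_{i=1}^{d}\log\max(1,|\alpha^{(i)}|)\Big)$$ be its absolute logarithmic Weil height. For integers $m,n\ge 0$ put $$D_{m,n}=\frac{m!}{\prod_{q\le n,\ q\text{ prime}}q^{v_q(m!)}},$$ where $v_q$ is the $q$-adic valuation, and let $d_n$ be the least common multiple of $1,\dots,n$, with $d_0=1$. **Theorem.** Let $\alpha,\beta\in\mathbb C$ be algebraic numbers with $\beta\neq 0$, and put $D=[\mathbb Q(\alpha,\beta):\mathbb Q]/[\mathbb R(\alpha,\beta):\mathbb R]$. Let $\mathcal A\ge 1$ and $\mathcal B\ge 1$ be real numbers such that $$D\,h(\alpha)-\log\max(1,|\alpha|)\le\log\mathcal A,\qquad D\,h(\beta)-\log\max(1,|\beta|)\le\log\mathcal B.$$ Let $K\ge 1$ and $L\ge 2$ be integers and let $E>1$ be a real number such that $$\begin{aligned}KL\log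 E\ \ge\ & DKL\log 2+D(K-1)\log\big(e\sqrt{3L}\,d_{L-1}\big)+D\log\big(D_{K-1,L-1}\big)\\&+D\log\Big((4e)^{L-1}\min\big(d_{L-2}^{\,K-1},(L-2)!\big)\Big)+\log\big((K-1)!\big)\\&+(K-1)\log(\mathcal B/2)+(L-1)\log(\mathcal A/2)+LE|\beta|+L\log E.\end{aligned}$$ Then $$\big|e^{\beta}-\alpha\big|\ \ge\ E^{-KL}.$$ -/

import Mathlib

open Polynomial IntermediateField

noncomputable section

/-- The minimal polynomial over `ℤ` of an algebraic number `α` (determined up to sign): the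
primitive polynomial with integer coefficients proportional to the monic minimal polynomial
of `α` over `ℚ`. -/
def intMinpoly (α : ℂ) : ℤ[X] :=
  (IsLocalization.integerNormalization (nonZeroDivisors ℤ) (minpoly ℚ α)).primPart

/-- The absolute logarithmic Weil height of an algebraic number `α`. -/
def weilHeight (α : ℂ) : ℝ :=
  (1 / ((intMinpoly α).natDegree : ℝ)) *
    (Real.log |((intMinpoly α).leadingCoeff : ℝ)| +
      (((intMinpoly α).aroots ℂ).map fun z => Real.log (max 1 ‖z‖)).sum)

/-- `[ℚ(α, β) : ℚ] / [ℝ(α, β) : ℝ]`, a real number (possibly a half-integer). -/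
def degreeRatio (α β : ℂ) : ℝ :=
  (Module.finrank ℚ ℚ⟮α, β⟯ : ℝ) / (Module.finrank ℝ ℝ⟮α, β⟯ : ℝ)

/-- `m!` divided by the product of `q ^ v_q(m!)` over the primes `q ≤ n`. -/
def factorialPart (m n : ℕ) : ℝ :=
  (m.factorial : ℝ) /
    ∏ q ∈ (Finset.Icc 1 n).filter Nat.Prime, (q : ℝ) ^ padicValNat q m.factorial

/-- The least common multiple of `1, …, n`, equal to `1` for `n = 0`. -/
def lcmUpTo (n : ℕ) : ℕ := (Finset.Icc 1 n).lcm id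

end

/-! Let `M = K - 1`. Decomposing `1 / ∏ l, (X - l) ^ n l` into partial fractions, `l` running over
`0, …, L - 1`, yields Hermite–Padé forms `∑ l, p l * exp (l * X)` vanishing at `0` to order
`∑ l, n l - 1`. Take all the `n l` equal to `M`, except one which is `M + 1`: the order is `M * L`,
and the `L` forms so obtained have as determinant a nonzero multiple of `X ^ (M * L)`, because it
has degree at most `M * L` and is divisible by `X ^ (M * L)`. Hence one of them does not vanish at
`X = β` when `exp β` is replaced by `α`. Clearing denominators gives an integral form whose value
at `(β, α)` is bounded below by Liouville's inequality. If `‖exp β - α‖ < E ^ (-K * L)`, this value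
is close to the value at `(β, exp β)`, which is small because of the vanishing order. The two
estimates are incompatible under the assumption on the parameters.
-/

section GaussLemma

variable {k : Type*} [Field k] (V : ValuationSubring k)

lemma exists_X_sub_C_eq_C_mul_map (z : k) :
    ∃ (c : k) (g : V[X]), V.valuation c = max 1 (V.valuation z) ∧
      g.map (IsLocalRing.residue V) ≠ 0 ∧ X - C z = C c * g.map (algebraMap V k) := by
  by_cases hz : z ∈ V
  · refine ⟨1, X - C ⟨z, hz⟩, ?_, ?_, ?_⟩
    · rw [map_one, max_eq_left ((V.valuation_le_one_iff z).2 hz)]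
    · simpa using X_sub_C_ne_zero _
    · simp [ValuationSubring.algebraMap_apply]
  · have hz0 : z ≠ 0 := fun h => hz (h ▸ V.zero_mem)
    have hz1 : 1 < V.valuation z := by rwa [← not_le, V.valuation_le_one_iff]
    refine ⟨z, C ⟨z⁻¹, (V.mem_or_inv_mem z).resolve_left hz⟩ * X - 1,
      (max_eq_right hz1.le).symm, fun h => ?_, ?_⟩
    · simpa using congrArg (coeff · 0) h
    · simp [ValuationSubring.algebraMap_apply, mul_sub, ← mul_assoc, ← C_mul, hz0]

lemma exists_prod_X_sub_C_eq_C_mul_map (s : Multiset k) :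
    ∃ (c : k) (g : V[X]), V.valuation c = (s.map fun z => max 1 (V.valuation z)).prod ∧
      g.map (IsLocalRing.residue V) ≠ 0 ∧
      (s.map fun z => X - C z).prod = C c * g.map (algebraMap V k) := by
  induction s using Multiset.induction_on with
  | empty => exact ⟨1, 1, by simp⟩
  | cons z s ih =>
    obtain ⟨c, g, hc, hg, hs⟩ := ih
    obtain ⟨c', g', hc', hg', hz⟩ := exists_X_sub_C_eq_C_mul_map V z
    refine ⟨c' * c, g' * g, ?_, ?_, ?_⟩
    · rw [map_mul, hc, hc', Multiset.map_cons, Multiset.prod_cons]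
    · rw [Polynomial.map_mul]
      exact mul_ne_zero hg' hg
    · rw [Multiset.map_cons, Multiset.prod_cons, hz, hs, Polynomial.map_mul, C_mul]
      ring

lemma valuation_mul_prod_max_one_le_one {s : Multiset k} {a : k}
    (h : ∀ n, (C a * (s.map fun z => X - C z).prod).coeff n ∈ V) :
    V.valuation a * (s.map fun z => max 1 (V.valuation z)).prod ≤ 1 := by
  obtain ⟨c, g, hc, hg, hs⟩ := exists_prod_X_sub_C_eq_C_mul_map V s
  obtain ⟨n, hn⟩ : ∃ n, IsLocalRing.residue V (g.coeff n) ≠ 0 := by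
    contrapose! hg
    ext n
    rw [coeff_map, hg, coeff_zero]
  have hunit : V.valuation (g.coeff n : k) = 1 := by
    exact (V.valuation_eq_one_iff _).1 ((IsLocalRing.residue_ne_zero_iff_isUnit _).1 hn)
  have hcoeff := (V.valuation_le_one_iff _).2 (h n)
  rwa [hs, ← mul_assoc, ← C_mul, coeff_C_mul, coeff_map, map_mul, map_mul, hc,
    ValuationSubring.algebraMap_apply, hunit, mul_one] at hcoeff

lemma isIntegral_int_of_forall_mem_valuationSubring {x : k}
    (h : ∀ V : ValuationSubring k, x ∈ V) : IsIntegral ℤ x := by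
  by_contra hx
  obtain ⟨V, -, hV⟩ := Subring.exists_le_valuationSubring_of_isIntegrallyClosedIn
    (R := (integralClosure ℤ k).toSubring) hx
  exact hV (h V)

end GaussLemma

section IntMinpoly

variable {α : ℂ}

lemma exists_map_intMinpoly_eq (hα : IsAlgebraic ℚ α) :
    ∃ c : ℚ, c ≠ 0 ∧ (intMinpoly α).map (algebraMap ℤ ℚ) = C c * minpoly ℚ α := by
  obtain ⟨b, hb, hmap⟩ :=
    IsLocalization.integerNormalization_spec (nonZeroDivisors ℤ) (minpoly ℚ α)
  set f := IsLocalization.integerNormalization (nonZeroDivisors ℤ) (minpoly ℚ α) with hf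
  have hcontent : (f.content : ℚ) ≠ 0 := by
    rw [Int.cast_ne_zero, Ne, content_eq_zero_iff, hf,
      IsFractionRing.integerNormalization_eq_zero_iff]
    exact minpoly.ne_zero hα.isIntegral
  have hprim : f.map (algebraMap ℤ ℚ) =
      C (f.content : ℚ) * (intMinpoly α).map (algebraMap ℤ ℚ) := by
    conv_lhs => rw [f.eq_C_content_mul_primPart]
    rw [Polynomial.map_mul, map_C]
    rfl
  have hnorm : f.map (algebraMap ℤ ℚ) = C (b : ℚ) * minpoly ℚ α := by
    rw [hmap]
    ext n
    simp
  refine ⟨(f.content : ℚ)⁻¹ * b, ?_, ?_⟩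
  · simp [hcontent, nonZeroDivisors.ne_zero hb]
  · rw [C_mul, mul_assoc, ← hnorm, hprim, ← mul_assoc, ← C_mul, inv_mul_cancel₀ hcontent, C_1,
      one_mul]

lemma intMinpoly_ne_zero (hα : IsAlgebraic ℚ α) : intMinpoly α ≠ 0 := by
  obtain ⟨c, hc, h⟩ := exists_map_intMinpoly_eq hα
  intro h0
  rw [h0, Polynomial.map_zero, eq_comm, mul_eq_zero, C_eq_zero] at h
  exact h.elim hc (minpoly.ne_zero hα.isIntegral)

lemma natDegree_intMinpoly (hα : IsAlgebraic ℚ α) :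
    (intMinpoly α).natDegree = (minpoly ℚ α).natDegree := by
  obtain ⟨c, hc, h⟩ := exists_map_intMinpoly_eq hα
  rw [← natDegree_map_eq_of_injective (algebraMap ℤ ℚ).injective_int, h, natDegree_C_mul hc]

lemma aroots_intMinpoly (hα : IsAlgebraic ℚ α) :
    (intMinpoly α).aroots ℂ = (minpoly ℚ α).aroots ℂ := by
  obtain ⟨c, hc, h⟩ := exists_map_intMinpoly_eq hα
  rw [← aroots_map ℂ ℚ, h, aroots_C_mul _ hc]

lemma valuation_leadingCoeff_mul_prod_aroots_le_one (V : ValuationSubring ℂ)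
    (hα : IsAlgebraic ℚ α) :
    V.valuation ((intMinpoly α).leadingCoeff : ℂ) *
      (((minpoly ℚ α).aroots ℂ).map fun z => max 1 (V.valuation z)).prod ≤ 1 := by
  rw [← aroots_intMinpoly hα]
  refine valuation_mul_prod_max_one_le_one V fun n => ?_
  have hsplit := (IsAlgClosed.splits ((intMinpoly α).map (algebraMap ℤ ℂ))).eq_prod_roots
  rw [leadingCoeff_map_of_injective (algebraMap ℤ ℂ).injective_int, eq_intCast] at hsplit
  rw [aroots_def, ← hsplit, coeff_map, eq_intCast]
  exact intCast_mem V _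

end IntMinpoly

section Embeddings

lemma prod_embeddings_comp_val {k F E M : Type*} [Field k] [CharZero k] [Field F] [Algebra k F]
    [FiniteDimensional k F] [Field E] [IsAlgClosed E] [Algebra k E] [CommMonoid M]
    (K : IntermediateField k F) (g : (K →ₐ[k] E) → M) :
    ∏ σ : F →ₐ[k] E, g (σ.comp K.val) = (∏ τ, g τ) ^ Module.finrank K F := by
  rw [Fintype.prod_equiv algHomEquivSigma (fun σ : F →ₐ[k] E => g (σ.comp K.val))
    (fun σ : Σ τ : K →ₐ[k] E, @AlgHom K F E _ _ _ _ τ.toRingHom.toAlgebra => g σ.1)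
    fun σ => rfl, ← Finset.univ_sigma_univ, Finset.prod_sigma, ← Finset.prod_pow]
  refine Finset.prod_congr rfl fun τ _ => ?_
  let : Algebra K E := τ.toRingHom.toAlgebra
  calc _ = g τ ^ Fintype.card (F →ₐ[K] E) := by simp only [Finset.prod_const, Finset.card_univ]
    _ = _ := by rw [AlgHom.card]

lemma prod_embeddings_adjoin_simple {k F E M : Type*} [Field k] [CharZero k] [Field F]
    [Algebra k F] [FiniteDimensional k F] [Field E] [Algebra k E] [CommMonoid M] (x : F)
    (g : E → M) :
    ∏ τ : k⟮x⟯ →ₐ[k] E, g (τ (AdjoinSimple.gen k x)) = (((minpoly k x).aroots E).map g).prod := by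
  classical
  have hx : IsIntegral k x := Algebra.IsIntegral.isIntegral x
  have hnodup : ((minpoly k x).aroots E).Nodup :=
    nodup_roots (minpoly.irreducible hx).separable.map
  let pb := adjoin.powerBasis hx
  have hmin : minpoly k pb.gen = minpoly k x := by rw [adjoin.powerBasis_gen, minpoly_gen]
  rw [← hmin] at hnodup ⊢
  rw [Fintype.prod_equiv pb.liftEquiv' (fun τ => g (τ (AdjoinSimple.gen k x))) (fun z => g z.1)
    fun τ => by rw [PowerBasis.liftEquiv'_apply_coe, adjoin.powerBasis_gen],
    Finset.prod_mem_multiset _ (fun z => g z.1) g fun _ => rfl, Finset.prod_eq_multiset_prod,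
    Multiset.toFinset_val, Multiset.dedup_eq_self.mpr hnodup]

lemma prod_embeddings_eq_prod_aroots_pow {k F E M : Type*} [Field k] [CharZero k] [Field F]
    [Algebra k F] [FiniteDimensional k F] [Field E] [IsAlgClosed E] [Algebra k E] [CommMonoid M]
    (x : F) (g : E → M) :
    ∏ σ : F →ₐ[k] E, g (σ x) =
      (((minpoly k x).aroots E).map g).prod ^ Module.finrank k⟮x⟯ F := by
  rw [← prod_embeddings_adjoin_simple,
    ← prod_embeddings_comp_val k⟮x⟯ fun τ => g (τ (AdjoinSimple.gen k x))]
  simp only [AlgHom.comp_apply, coe_val, AdjoinSimple.coe_gen]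

lemma adjoin_real_eq_bot_of_forall_conj_eq {A : Set ℂ} (hA : ∀ z ∈ A, (starRingEnd ℂ) z = z) :
    adjoin ℝ A = ⊥ := by
  rw [eq_bot_iff, adjoin_le_iff]
  intro z hz
  obtain ⟨r, hr⟩ := Complex.conj_eq_iff_real.1 (hA z hz)
  exact IntermediateField.mem_bot.2 ⟨r, hr.symm⟩

lemma finrank_real_eq_two_of_ne_bot {K : IntermediateField ℝ ℂ} (hK : K ≠ ⊥) :
    Module.finrank ℝ K = 2 := by
  have hdvd : Module.finrank ℝ K ∣ 2 :=
    ⟨_, Complex.finrank_real_complex.symm.trans (Module.finrank_mul_finrank ℝ K ℂ).symm⟩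
  exact ((Nat.dvd_prime Nat.prime_two).1 hdvd).resolve_left fun h =>
    hK (IntermediateField.finrank_eq_one_iff.1 h)

/-- Such embeddings are `φ` itself and, unless `φ` is real on `T`, its complex conjugate. -/
lemma exists_finset_embeddings_norm_eq {F : Type*} [Field F] [Algebra ℚ F] (φ : F →ₐ[ℚ] ℂ)
    (T : Set F) :
    ∃ S : Finset (F →ₐ[ℚ] ℂ), S.card = Module.finrank ℝ (adjoin ℝ (φ '' T)) ∧
      ∀ σ ∈ S, ∀ z, ‖σ z‖ = ‖φ z‖ := by
  classical
  by_cases hreal : adjoin ℝ (φ '' T) = ⊥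
  · exact ⟨{φ}, by rw [hreal, IntermediateField.finrank_bot, Finset.card_singleton], by simp⟩
  · let φbar : F →ₐ[ℚ] ℂ := (Complex.conjAe.restrictScalars ℚ : ℂ →ₐ[ℚ] ℂ).comp φ
    have hne : φ ≠ φbar := by
      refine fun h => hreal (adjoin_real_eq_bot_of_forall_conj_eq ?_)
      rintro _ ⟨z, -, rfl⟩
      exact (DFunLike.congr_fun h z).symm
    refine ⟨{φ, φbar}, ?_, ?_⟩
    · rw [Finset.card_pair hne, finrank_real_eq_two_of_ne_bot hreal]
    · simp [φbar]

end Embeddings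

section MvPolynomialBounds

variable {κ : Type*}

/-- The length of a polynomial with integer coefficients: the sum of their absolute values. -/
def coeffLength (P : MvPolynomial κ ℤ) : ℝ := ∑ m ∈ P.support, |((P.coeff m : ℤ) : ℝ)|

lemma map_aeval_int {κ A B : Type*} [CommRing A] [CommRing B] (f : A →+* B) (x : κ → A)
    (P : MvPolynomial κ ℤ) :
    f (MvPolynomial.aeval x P) = MvPolynomial.aeval (fun i => f (x i)) P :=
  MvPolynomial.comp_aeval_apply x f.toIntAlgHom P

lemma pow_le_max_one_pow {R : Type*} [MonoidWithZero R] [LinearOrder R] [ZeroLEOneClass R]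
    [PosMulMono R] [MulPosMono R] {a : R} (ha : 0 ≤ a) {m n : ℕ} (h : m ≤ n) :
    a ^ m ≤ max 1 a ^ n :=
  (pow_le_pow_left₀ ha (le_max_right _ _) m).trans (pow_le_pow_right₀ (le_max_left _ _) h)

variable [Fintype κ] {P : MvPolynomial κ ℤ} {n : κ → ℕ}

lemma norm_aeval_le_coeffLength_mul (hn : ∀ i, P.degreeOf i ≤ n i) (x : κ → ℂ) :
    ‖MvPolynomial.aeval x P‖ ≤ coeffLength P * ∏ i, max 1 ‖x i‖ ^ n i := by
  rw [MvPolynomial.aeval_def, MvPolynomial.eval₂_eq', coeffLength, Finset.sum_mul]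
  refine norm_sum_le_of_le _ fun m hm => ?_
  rw [norm_mul, norm_prod, eq_intCast, Complex.norm_intCast]
  refine mul_le_mul_of_nonneg_left (Finset.prod_le_prod (fun _ _ => norm_nonneg _) fun i _ => ?_)
    (abs_nonneg _)
  rw [norm_pow]
  exact pow_le_max_one_pow (norm_nonneg _) ((MvPolynomial.monomial_le_degreeOf i hm).trans (hn i))

lemma valuation_aeval_le {k : Type*} [Field k] (V : ValuationSubring k)
    (hn : ∀ i, P.degreeOf i ≤ n i) (x : κ → k) :
    V.valuation (MvPolynomial.aeval x P) ≤ ∏ i, max 1 (V.valuation (x i)) ^ n i := by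
  rw [MvPolynomial.aeval_def, MvPolynomial.eval₂_eq']
  refine Valuation.map_sum_le _ fun m hm => ?_
  rw [map_mul, map_prod, eq_intCast]
  refine mul_le_of_le_one_of_le ((V.valuation_le_one_iff _).2 (intCast_mem V _))
    (Finset.prod_le_prod' fun i _ => ?_)
  rw [map_pow]
  exact pow_le_max_one_pow zero_le ((MvPolynomial.monomial_le_degreeOf i hm).trans (hn i))

end MvPolynomialBounds

section Liouville

variable {F : Type*} [Field F] [Algebra ℚ F] [FiniteDimensional ℚ F] (φ : F →ₐ[ℚ] ℂ)

lemma isAlgebraic_embedding (x : F) : IsAlgebraic ℚ (φ x) :=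
  ((Algebra.IsIntegral.isIntegral x).map φ).isAlgebraic

lemma finrank_mul_weilHeight (x : F) :
    Module.finrank ℚ F * weilHeight (φ x) =
      Module.finrank ℚ⟮x⟯ F * Real.log |((intMinpoly (φ x)).leadingCoeff : ℝ)| +
        ∑ σ : F →ₐ[ℚ] ℂ, Real.log (max 1 ‖σ x‖) := by
  have hx : IsIntegral ℚ x := Algebra.IsIntegral.isIntegral x
  have hsum : ∑ σ : F →ₐ[ℚ] ℂ, Real.log (max 1 ‖σ x‖) = Module.finrank ℚ⟮x⟯ F *
      (((minpoly ℚ x).aroots ℂ).map fun z => Real.log (max 1 ‖z‖)).sum := by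
    have h := congrArg Multiplicative.toAdd (prod_embeddings_eq_prod_aroots_pow (k := ℚ) x
      fun z : ℂ => Multiplicative.ofAdd (Real.log (max 1 ‖z‖)))
    rwa [toAdd_prod, toAdd_pow, nsmul_eq_mul, toAdd_multiset_sum, Multiset.map_map] at h
  have hdeg : (Module.finrank ℚ F : ℝ) = (minpoly ℚ x).natDegree * Module.finrank ℚ⟮x⟯ F := by
    rw [← adjoin.finrank hx]
    exact_mod_cast (Module.finrank_mul_finrank ℚ ℚ⟮x⟯ F).symm
  have hdeg0 : ((minpoly ℚ x).natDegree : ℝ) ≠ 0 := by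
    exact_mod_cast (minpoly.natDegree_pos hx).ne'
  rw [hsum, hdeg, weilHeight, aroots_intMinpoly (isAlgebraic_embedding φ x),
    natDegree_intMinpoly (isAlgebraic_embedding φ x), minpoly.algHom_eq φ φ.injective x]
  field_simp

lemma valuation_leadingCoeff_pow_mul_prod_embeddings_le_one (V : ValuationSubring ℂ) (x : F) :
    V.valuation ((intMinpoly (φ x)).leadingCoeff : ℂ) ^ Module.finrank ℚ⟮x⟯ F *
      ∏ σ : F →ₐ[ℚ] ℂ, max 1 (V.valuation (σ x)) ≤ 1 := by
  rw [prod_embeddings_eq_prod_aroots_pow (k := ℚ) x fun z => max 1 (V.valuation z), ← mul_pow,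
    ← minpoly.algHom_eq φ φ.injective x]
  exact pow_le_one' (valuation_leadingCoeff_mul_prod_aroots_le_one V (isAlgebraic_embedding φ x)) _

lemma one_le_norm_ratCast_of_isIntegral {q : ℚ} (hq : IsIntegral ℤ (q : ℂ)) (hq0 : q ≠ 0) :
    1 ≤ ‖(q : ℂ)‖ := by
  have hq' : IsIntegral ℤ q :=
    (isIntegral_algHom_iff (Rat.castHom ℂ).toIntAlgHom (Rat.castHom ℂ).injective).1 hq
  obtain ⟨n, rfl⟩ := IsIntegrallyClosed.isIntegral_iff.1 hq'
  have hn : n ≠ 0 := by simpa using hq0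
  simpa using (by exact_mod_cast Int.one_le_abs hn : (1 : ℝ) ≤ |(n : ℝ)|)

variable {κ : Type*} [Fintype κ] {P : MvPolynomial κ ℤ} {n : κ → ℕ}
  (hn : ∀ i, P.degreeOf i ≤ n i)

include hn in
lemma isIntegral_leadingCoeff_pow_mul_norm_aeval (x : κ → F) :
    IsIntegral ℤ ((∏ i, ((intMinpoly (φ (x i))).leadingCoeff : ℂ) ^
      (Module.finrank ℚ⟮x i⟯ F * n i)) * (Algebra.norm ℚ (MvPolynomial.aeval x P) : ℂ)) := by
  refine isIntegral_int_of_forall_mem_valuationSubring fun V => ?_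
  have hnorm : (Algebra.norm ℚ (MvPolynomial.aeval x P) : ℂ) =
      ∏ σ : F →ₐ[ℚ] ℂ, MvPolynomial.aeval (fun i => σ (x i)) P := by
    rw [← eq_ratCast (algebraMap ℚ ℂ), Algebra.norm_eq_prod_embeddings]
    exact Finset.prod_congr rfl fun σ _ => map_aeval_int σ.toRingHom x P
  rw [← V.valuation_le_one_iff, hnorm, map_mul, map_prod, map_prod]
  calc _ ≤ (∏ i, V.valuation (((intMinpoly (φ (x i))).leadingCoeff : ℂ) ^
          (Module.finrank ℚ⟮x i⟯ F * n i))) *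
        ∏ σ : F →ₐ[ℚ] ℂ, ∏ i, max 1 (V.valuation (σ (x i))) ^ n i :=
        mul_le_mul' le_rfl (Finset.prod_le_prod' fun σ _ => valuation_aeval_le V hn _)
    _ = ∏ i, (V.valuation ((intMinpoly (φ (x i))).leadingCoeff : ℂ) ^ Module.finrank ℚ⟮x i⟯ F *
          ∏ σ : F →ₐ[ℚ] ℂ, max 1 (V.valuation (σ (x i)))) ^ n i := by
        rw [Finset.prod_comm, ← Finset.prod_mul_distrib]
        simp only [map_pow, Finset.prod_pow, mul_pow, pow_mul]
    _ ≤ 1 := Finset.prod_le_one' fun i _ =>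
        pow_le_one' (valuation_leadingCoeff_pow_mul_prod_embeddings_le_one φ V (x i)) _

include hn in
lemma one_le_leadingCoeff_pow_mul_prod_embeddings {x : κ → F}
    (hP : MvPolynomial.aeval x P ≠ 0) :
    1 ≤ (∏ i, |((intMinpoly (φ (x i))).leadingCoeff : ℝ)| ^ (Module.finrank ℚ⟮x i⟯ F * n i)) *
      ∏ σ : F →ₐ[ℚ] ℂ, ‖σ (MvPolynomial.aeval x P)‖ := by
  have hlc (i : κ) : ((intMinpoly (φ (x i))).leadingCoeff : ℚ) ≠ 0 := by
    exact_mod_cast leadingCoeff_ne_zero.2 (intMinpoly_ne_zero (isAlgebraic_embedding φ (x i)))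
  have hint := isIntegral_leadingCoeff_pow_mul_norm_aeval φ hn x
  have hge := one_le_norm_ratCast_of_isIntegral
    (q := (∏ i, ((intMinpoly (φ (x i))).leadingCoeff : ℚ) ^ (Module.finrank ℚ⟮x i⟯ F * n i)) *
      Algebra.norm ℚ (MvPolynomial.aeval x P)) (by push_cast; exact hint)
    (mul_ne_zero (Finset.prod_ne_zero_iff.2 fun i _ => pow_ne_zero _ (hlc i))
      (Algebra.norm_ne_zero_iff.2 hP))
  rw [Rat.cast_mul, ← eq_ratCast (algebraMap ℚ ℂ) (Algebra.norm ℚ _),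
    Algebra.norm_eq_prod_embeddings, norm_mul, norm_prod] at hge
  simpa [norm_prod] using hge

include hn in
lemma log_leadingCoeff_add_sum_log_norm_nonneg {x : κ → F} (hP : MvPolynomial.aeval x P ≠ 0) :
    0 ≤ ∑ i, n i * (Module.finrank ℚ⟮x i⟯ F *
        Real.log |((intMinpoly (φ (x i))).leadingCoeff : ℝ)|) +
      ∑ σ : F →ₐ[ℚ] ℂ, Real.log ‖σ (MvPolynomial.aeval x P)‖ := by
  have hlc (i : κ) : |((intMinpoly (φ (x i))).leadingCoeff : ℝ)| ^
      (Module.finrank ℚ⟮x i⟯ F * n i) ≠ 0 :=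
    pow_ne_zero _ (by simpa using intMinpoly_ne_zero (isAlgebraic_embedding φ (x i)))
  have hσ (σ : F →ₐ[ℚ] ℂ) : ‖σ (MvPolynomial.aeval x P)‖ ≠ 0 := by
    rwa [norm_ne_zero_iff, _root_.map_ne_zero]
  have hlog := Real.log_nonneg (one_le_leadingCoeff_pow_mul_prod_embeddings φ hn hP)
  rw [Real.log_mul (Finset.prod_ne_zero_iff.2 fun i _ => hlc i)
    (Finset.prod_ne_zero_iff.2 fun σ _ => hσ σ), Real.log_prod fun i _ => hlc i,
    Real.log_prod fun σ _ => hσ σ] at hlog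
  refine hlog.trans_eq (congrArg (· + _) (Finset.sum_congr rfl fun i _ => ?_))
  rw [Real.log_pow]
  push_cast
  ring

include hn in
lemma log_norm_aeval_le {x : κ → ℂ} (hP : MvPolynomial.aeval x P ≠ 0) :
    Real.log ‖MvPolynomial.aeval x P‖ ≤
      Real.log (coeffLength P) + ∑ i, n i * Real.log (max 1 ‖x i‖) := by
  have hpos (i : κ) : 0 < max 1 ‖x i‖ ^ n i := by positivity
  have hle := norm_aeval_le_coeffLength_mul hn x
  have hlength : 0 < coeffLength P :=
    pos_of_mul_pos_left ((norm_pos_iff.2 hP).trans_le hle)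
      (Finset.prod_nonneg fun i _ => (hpos i).le)
  refine (Real.log_le_log (norm_pos_iff.2 hP) hle).trans_eq ?_
  rw [Real.log_mul hlength.ne' (Finset.prod_ne_zero_iff.2 fun i _ => (hpos i).ne'),
    Real.log_prod fun i _ => (hpos i).ne']
  simp only [Real.log_pow]

include hn in
/-- Dividing by `S.card` turns the degree of `F` into the quotient that defines `degreeRatio`. -/
lemma liouville_inequality {x : κ → F} (hP : MvPolynomial.aeval x P ≠ 0)
    {S : Finset (F →ₐ[ℚ] ℂ)} (hS : ∀ σ ∈ S, ∀ z, ‖σ z‖ = ‖φ z‖) :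
    0 ≤ S.card * Real.log ‖φ (MvPolynomial.aeval x P)‖ +
      (Module.finrank ℚ F - S.card) * Real.log (coeffLength P) +
      ∑ i, n i * (Module.finrank ℚ F * weilHeight (φ (x i)) -
        S.card * Real.log (max 1 ‖φ (x i)‖)) := by
  classical
  have hsplit (f : (F →ₐ[ℚ] ℂ) → ℝ) : ∑ σ, f σ = ∑ σ ∈ S, f σ + ∑ σ ∈ Sᶜ, f σ :=
    (Finset.sum_add_sum_compl S f).symm
  have hS_sum (g : ℝ → ℝ) (z : F) : ∑ σ ∈ S, g ‖σ z‖ = S.card * g ‖φ z‖ := by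
    rw [Finset.sum_congr rfl fun σ hσ => by rw [hS σ hσ z], Finset.sum_const, nsmul_eq_mul]
  have hcard : (Sᶜ.card : ℝ) = Module.finrank ℚ F - S.card := by
    rw [eq_sub_iff_add_eq', ← AlgHom.card ℚ F ℂ]
    exact_mod_cast S.card_add_card_compl
  have houter : ∑ σ ∈ Sᶜ, Real.log ‖σ (MvPolynomial.aeval x P)‖ ≤ ∑ σ ∈ Sᶜ,
      (Real.log (coeffLength P) + ∑ i, n i * Real.log (max 1 ‖σ (x i)‖)) := by
    refine Finset.sum_le_sum fun σ _ => ?_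
    have hσ : σ (MvPolynomial.aeval x P) = MvPolynomial.aeval (fun i => σ (x i)) P :=
      map_aeval_int σ.toRingHom x P
    rw [hσ]
    exact log_norm_aeval_le hn (hσ ▸ (_root_.map_ne_zero σ).2 hP)
  have hheight (i : κ) : Module.finrank ℚ F * weilHeight (φ (x i)) -
      S.card * Real.log (max 1 ‖φ (x i)‖) =
      Module.finrank ℚ⟮x i⟯ F * Real.log |((intMinpoly (φ (x i))).leadingCoeff : ℝ)| +
        ∑ σ ∈ Sᶜ, Real.log (max 1 ‖σ (x i)‖) := by
    rw [finrank_mul_weilHeight, hsplit, hS_sum fun r => Real.log (max 1 r)]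
    ring
  have hprod := log_leadingCoeff_add_sum_log_norm_nonneg φ hn hP
  rw [hsplit, hS_sum Real.log] at hprod
  rw [Finset.sum_add_distrib, Finset.sum_const, nsmul_eq_mul, hcard, Finset.sum_comm] at houter
  simp only [hheight, mul_add, Finset.sum_add_distrib, Finset.mul_sum] at hprod houter ⊢
  linarith

end Liouville

section DegreeRatio

variable {α β : ℂ}

lemma finrank_real_adjoin_image_le {F : Type*} [Field F] [Algebra ℚ F] [FiniteDimensional ℚ F]
    (φ : F →ₐ[ℚ] ℂ) (T : Set F) :
    Module.finrank ℝ (adjoin ℝ (φ '' T)) ≤ Module.finrank ℚ F := by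
  obtain ⟨S, hcard, -⟩ := exists_finset_embeddings_norm_eq φ T
  rw [← hcard, ← AlgHom.card ℚ F ℂ]
  exact S.card_le_univ

lemma finiteDimensional_adjoin_pair (hα : IsAlgebraic ℚ α) (hβ : IsAlgebraic ℚ β) :
    FiniteDimensional ℚ ℚ⟮α, β⟯ := by
  refine finiteDimensional_adjoin fun z hz => ?_
  rcases hz with rfl | rfl
  exacts [hα.isIntegral, hβ.isIntegral]

lemma val_image_preimage_pair :
    (ℚ⟮α, β⟯).val '' ((ℚ⟮α, β⟯).val ⁻¹' {α, β}) = {α, β} := by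
  refine Set.image_preimage_eq_of_subset fun z hz => ?_
  rw [← AlgHom.coe_range, range_val]
  exact subset_adjoin _ _ hz

lemma one_le_degreeRatio (hα : IsAlgebraic ℚ α) (hβ : IsAlgebraic ℚ β) :
    1 ≤ degreeRatio α β := by
  have := finiteDimensional_adjoin_pair hα hβ
  have hle := finrank_real_adjoin_image_le (ℚ⟮α, β⟯).val
    ((ℚ⟮α, β⟯).val ⁻¹' {α, β})
  rw [val_image_preimage_pair] at hle
  have hpos : 0 < Module.finrank ℝ ℝ⟮α, β⟯ := Module.finrank_pos
  rw [degreeRatio, one_le_div (by exact_mod_cast hpos)]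
  exact_mod_cast hle

lemma liouville_inequality_degreeRatio (hα : IsAlgebraic ℚ α) (hβ : IsAlgebraic ℚ β)
    {P : MvPolynomial (Fin 2) ℤ} {M N : ℕ} (hM : P.degreeOf 0 ≤ M) (hN : P.degreeOf 1 ≤ N)
    (hP : MvPolynomial.aeval ![β, α] P ≠ 0) :
    0 ≤ Real.log ‖MvPolynomial.aeval ![β, α] P‖ +
      (degreeRatio α β - 1) * Real.log (coeffLength P) +
      M * (degreeRatio α β * weilHeight β - Real.log (max 1 ‖β‖)) +
      N * (degreeRatio α β * weilHeight α - Real.log (max 1 ‖α‖)) := by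
  have := finiteDimensional_adjoin_pair hα hβ
  let a : ℚ⟮α, β⟯ := ⟨α, subset_adjoin _ _ (by simp)⟩
  let b : ℚ⟮α, β⟯ := ⟨β, subset_adjoin _ _ (by simp)⟩
  obtain ⟨S, hcard, hS⟩ := exists_finset_embeddings_norm_eq (ℚ⟮α, β⟯).val
    ((ℚ⟮α, β⟯).val ⁻¹' {α, β})
  rw [val_image_preimage_pair] at hcard
  have hn : ∀ i, P.degreeOf i ≤ ![M, N] i := Fin.forall_fin_two.2 ⟨hM, hN⟩
  have hval : (ℚ⟮α, β⟯).val (MvPolynomial.aeval ![b, a] P) = MvPolynomial.aeval ![β, α] P := by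
    refine (map_aeval_int (ℚ⟮α, β⟯).val.toRingHom _ P).trans ?_
    congr 2
    exact funext (Fin.forall_fin_two.2 ⟨rfl, rfl⟩)
  have hP' : MvPolynomial.aeval ![b, a] P ≠ 0 := fun h => hP (by rw [← hval, h, map_zero])
  have h := liouville_inequality (ℚ⟮α, β⟯).val hn hP' hS
  rw [hval, hcard] at h
  have hpos : (0 : ℝ) < Module.finrank ℝ ℝ⟮α, β⟯ := by exact_mod_cast Module.finrank_pos
  refine (div_nonneg h hpos.le).trans_eq ?_
  simp only [Fin.sum_univ_two, Matrix.cons_val_zero, Matrix.cons_val_one, degreeRatio, coe_val]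
  field_simp
  ring

end DegreeRatio

section HermiteInterpolation

variable {k ι : Type*} [Field k] [Fintype ι] [DecidableEq ι] (v : ι → k) (n : ι → ℕ)

/-- The product of the `(X - v m) ^ n m` over the nodes `v m` other than `v l`. -/
noncomputable def nodalCofactor (l : ι) : k[X] := ∏ m ∈ Finset.univ.erase l, (X - C (v m)) ^ n m

/-- The expansion of the inverse of `nodalCofactor v n l` in powers of `X - v l`. -/
noncomputable def invNodalCofactor (l : ι) : PowerSeries k :=
  ∏ m ∈ Finset.univ.erase l, (PowerSeries.X + PowerSeries.C (v l - v m))⁻¹ ^ n m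

/-- The numerator over `(X - v l) ^ n l` of the partial fraction decomposition of
`f / ∏ m, (X - v m) ^ n m`, when this fraction is proper. -/
noncomputable def hermiteNumerator (f : k[X]) (l : ι) : k[X] :=
  taylor (-v l) (PowerSeries.trunc (n l) (invNodalCofactor v n l * (taylor (v l) f : k[X])))

lemma constantCoeff_X_add_C_ne_zero {a : k} (ha : a ≠ 0) :
    PowerSeries.constantCoeff (PowerSeries.X + PowerSeries.C a) ≠ 0 := by
  simpa using ha

variable {v}

lemma constantCoeff_invNodalCofactor_ne_zero (hv : Function.Injective v) (l : ι) :
    PowerSeries.constantCoeff (invNodalCofactor v n l) ≠ 0 := by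
  rw [invNodalCofactor, map_prod, Finset.prod_ne_zero_iff]
  intro m hm
  rw [map_pow, PowerSeries.constantCoeff_inv]
  exact pow_ne_zero _ (inv_ne_zero (constantCoeff_X_add_C_ne_zero
    (sub_ne_zero.2 (hv.ne (Finset.ne_of_mem_erase hm).symm))))

lemma invNodalCofactor_mul_taylor_nodalCofactor (hv : Function.Injective v) (l : ι) :
    invNodalCofactor v n l * (taylor (v l) (nodalCofactor v n l) : k[X]) = 1 := by
  have htaylor : ((taylor (v l) (nodalCofactor v n l) : k[X]) : PowerSeries k) =
      ∏ m ∈ Finset.univ.erase l, (PowerSeries.X + PowerSeries.C (v l - v m)) ^ n m := by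
    rw [nodalCofactor, ← taylorAlgHom_apply, ← coeToPowerSeries.ringHom_apply, map_prod, map_prod]
    refine Finset.prod_congr rfl fun m _ => ?_
    rw [map_pow, map_pow]
    congr 1
    simp [add_sub_assoc]
  rw [htaylor, invNodalCofactor, ← Finset.prod_mul_distrib]
  refine Finset.prod_eq_one fun m hm => ?_
  rw [← mul_pow, PowerSeries.inv_mul_cancel _ (constantCoeff_X_add_C_ne_zero
    (sub_ne_zero.2 (hv.ne (Finset.ne_of_mem_erase hm).symm))), one_pow]

lemma X_sub_C_pow_dvd_iff_X_pow_dvd_taylor (a : k) (N : ℕ) (f : k[X]) :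
    (X - C a) ^ N ∣ f ↔ PowerSeries.X ^ N ∣ ((taylor a f : k[X]) : PowerSeries k) := by
  rw [X_sub_C_pow_dvd_iff, ← taylor_apply, X_pow_dvd_iff, PowerSeries.X_pow_dvd_iff]
  simp only [coeff_coe]

variable (v) in
lemma nodalCofactor_monic (l : ι) : (nodalCofactor v n l).Monic :=
  monic_prod_of_monic _ _ fun m _ => (monic_X_sub_C (v m)).pow (n m)

variable (v) in
lemma natDegree_nodalCofactor_add (l : ι) :
    (nodalCofactor v n l).natDegree + n l = ∑ m, n m := by
  rw [nodalCofactor, natDegree_prod_of_monic _ _ fun m _ => (monic_X_sub_C (v m)).pow (n m),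
    ← Finset.sum_erase_add _ _ (Finset.mem_univ l)]
  simp

lemma X_sub_C_pow_dvd_sub_hermiteNumerator_mul (hv : Function.Injective v) (f : k[X]) (l : ι) :
    (X - C (v l)) ^ n l ∣ f - hermiteNumerator v n f l * nodalCofactor v n l := by
  rw [X_sub_C_pow_dvd_iff_X_pow_dvd_taylor]
  set g := invNodalCofactor v n l * (taylor (v l) f : k[X]) with hg
  have hf : ((taylor (v l) f : k[X]) : PowerSeries k) =
      g * (taylor (v l) (nodalCofactor v n l) : k[X]) := by
    rw [hg, mul_right_comm, invNodalCofactor_mul_taylor_nodalCofactor n hv, one_mul]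
  have hdiff : ((taylor (v l) (f - hermiteNumerator v n f l * nodalCofactor v n l) : k[X]) :
      PowerSeries k) = (g - (PowerSeries.trunc (n l) g : k[X])) *
        (taylor (v l) (nodalCofactor v n l) : k[X]) := by
    rw [map_sub, taylor_mul, hermiteNumerator, taylor_taylor, add_neg_cancel, taylor_zero,
      coe_sub, coe_mul, ← hg, hf, sub_mul]
  rw [hdiff]
  refine Dvd.dvd.mul_right ?_ _
  nth_rw 1 [PowerSeries.eq_X_pow_mul_shift_add_trunc (n l) g]
  rw [add_sub_cancel_right]
  exact dvd_mul_right _ _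

variable (v) in
lemma degree_hermiteNumerator_mul_lt (f : k[X]) (l : ι) :
    (hermiteNumerator v n f l * nodalCofactor v n l).degree < (∑ m, n m : ℕ) := by
  rw [degree_mul, degree_eq_natDegree (nodalCofactor_monic v n l).ne_zero,
    ← natDegree_nodalCofactor_add v n l, add_comm, Nat.cast_add, hermiteNumerator, degree_taylor]
  exact WithBot.add_lt_add_left WithBot.coe_ne_bot (PowerSeries.degree_trunc_lt _ _)

theorem sum_hermiteNumerator_mul_nodalCofactor (hv : Function.Injective v) {f : k[X]}
    (hf : f.degree < (∑ m, n m : ℕ)) :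
    ∑ l, hermiteNumerator v n f l * nodalCofactor v n l = f := by
  have hdvd : ∏ m, (X - C (v m)) ^ n m ∣
      f - ∑ l, hermiteNumerator v n f l * nodalCofactor v n l := by
    refine Finset.prod_dvd_of_coprime
      (fun i _ j _ hij => (pairwise_coprime_X_sub_C hv hij).pow) fun m _ => ?_
    rw [← Finset.add_sum_erase _ _ (Finset.mem_univ m), ← sub_sub]
    refine dvd_sub (X_sub_C_pow_dvd_sub_hermiteNumerator_mul n hv f m)
      (Finset.dvd_sum fun l hl => Dvd.dvd.mul_left (Finset.dvd_prod_of_mem _ ?_) _)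
    exact Finset.mem_erase.2 ⟨(Finset.ne_of_mem_erase hl).symm, Finset.mem_univ m⟩
  refine (sub_eq_zero.1 (eq_zero_of_dvd_of_degree_lt hdvd ?_)).symm
  have hdeg : (∏ m, (X - C (v m)) ^ n m).degree = ((∑ m, n m : ℕ) : WithBot ℕ) := by
    simp [degree_prod]
  rw [hdeg]
  refine (degree_sub_le _ _).trans_lt (max_lt hf ((degree_sum_le _ _).trans_lt ?_))
  exact (Finset.sup_lt_iff (WithBot.bot_lt_coe _)).2 fun l _ =>
    degree_hermiteNumerator_mul_lt v n f l

variable (v) in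
lemma coeff_hermiteNumerator_mul_nodalCofactor (f : k[X]) (l : ι) :
    (hermiteNumerator v n f l * nodalCofactor v n l).coeff (∑ m, n m - 1) =
      PowerSeries.coeff (n l) (PowerSeries.X *
        (invNodalCofactor v n l * ((taylor (v l) f : k[X]) : PowerSeries k))) := by
  obtain hl | ⟨d, hl⟩ : n l = 0 ∨ ∃ d, n l = d + 1 := by
    cases n l <;> simp
  · simp [hermiteNumerator, hl]
  have hsum : ∑ m, n m - 1 = d + (nodalCofactor v n l).natDegree := by
    have := natDegree_nodalCofactor_add v n l
    omega
  set T := PowerSeries.trunc (n l)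
    (invNodalCofactor v n l * ((taylor (v l) f : k[X]) : PowerSeries k)) with hT
  have hTdeg : T.natDegree ≤ d := by
    rw [hT, hl]
    exact Nat.lt_succ_iff.1 (PowerSeries.natDegree_trunc_lt _ d)
  have htop : (taylor (-v l) T).coeff d = T.coeff d := by
    rcases hTdeg.lt_or_eq with h | rfl
    · rw [coeff_eq_zero_of_natDegree_lt h,
        coeff_eq_zero_of_natDegree_lt (by rwa [natDegree_taylor])]
    · rw [coeff_taylor_natDegree, coeff_natDegree]
  rw [hsum, hermiteNumerator, coeff_mul_add_eq_of_natDegree_le (by rwa [natDegree_taylor]) le_rfl,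
    (nodalCofactor_monic v n l).coeff_natDegree, mul_one, htop, hT, PowerSeries.coeff_trunc, hl,
    if_pos d.lt_succ_self, PowerSeries.coeff_succ_X_mul]

theorem sum_coeff_invNodalCofactor_mul_taylor_eq_zero (hv : Function.Injective v) {f : k[X]}
    (hf : f.natDegree + 1 < ∑ m, n m) :
    ∑ l, PowerSeries.coeff (n l) (PowerSeries.X *
      (invNodalCofactor v n l * ((taylor (v l) f : k[X]) : PowerSeries k))) = 0 := by
  have hdeg : f.degree < (∑ m, n m : ℕ) :=
    degree_le_natDegree.trans_lt (Nat.cast_lt.2 (by omega))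
  simp only [← coeff_hermiteNumerator_mul_nodalCofactor]
  rw [← finsetSum_coeff, sum_hermiteNumerator_mul_nodalCofactor n hv hdeg]
  exact coeff_eq_zero_of_natDegree_lt (by omega)

end HermiteInterpolation

section HermitePade

variable {k ι : Type*} [Field k] [Fintype ι] [DecidableEq ι] (v : ι → k) (n : ι → ℕ)

/-- The coefficient of `(X - v l) ^ (-(s + 1))` in the partial fraction decomposition of
`∏ m, (X - v m) ^ (-n m)`. -/
noncomputable def partialFractionCoeff (l : ι) (s : ℕ) : k :=
  PowerSeries.coeff (n l) (PowerSeries.X ^ (s + 1) * invNodalCofactor v n l)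

/-- The polynomial multiplying `exp (v l * X)` in the Hermite–Padé form of type `n` for the series
`exp (v m * X)`, normalised so as to be the residue at `v l` of `exp (ζ * X) / ∏ (ζ - v m) ^ n m`,
divided by `exp (v l * X)`. -/
noncomputable def padePolynomial (l : ι) : k[X] :=
  ∑ s ∈ Finset.range (n l), monomial s (partialFractionCoeff v n l s / s.factorial)

variable {n}

lemma partialFractionCoeff_eq_zero {l : ι} {s : ℕ} (h : n l ≤ s) :
    partialFractionCoeff v n l s = 0 := by
  rw [partialFractionCoeff, PowerSeries.coeff_X_pow_mul', if_neg (by omega)]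

lemma coeff_padePolynomial (l : ι) (s : ℕ) :
    (padePolynomial v n l).coeff s = partialFractionCoeff v n l s / s.factorial := by
  simp only [padePolynomial, finsetSum_coeff, coeff_monomial, Finset.sum_ite_eq', Finset.mem_range]
  split_ifs with h
  · rfl
  · rw [partialFractionCoeff_eq_zero v (not_lt.1 h), zero_div]

lemma natDegree_padePolynomial_le {l : ι} {M : ℕ} (h : n l ≤ M + 1) :
    (padePolynomial v n l).natDegree ≤ M :=
  natDegree_le_iff_coeff_eq_zero.2 fun s hs => by
    rw [coeff_padePolynomial, partialFractionCoeff_eq_zero v (by omega), zero_div]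

lemma coeff_padePolynomial_ne_zero [CharZero k] {v : ι → k} (hv : Function.Injective v) {l : ι}
    {M : ℕ} (h : n l = M + 1) : (padePolynomial v n l).coeff M ≠ 0 := by
  rw [coeff_padePolynomial, partialFractionCoeff, h, PowerSeries.coeff_X_pow_mul', if_pos le_rfl,
    Nat.sub_self, PowerSeries.coeff_zero_eq_constantCoeff_apply]
  exact div_ne_zero (constantCoeff_invNodalCofactor_ne_zero n hv l)
    (by exact_mod_cast M.factorial_ne_zero)

lemma coeff_X_mul_invNodalCofactor_mul (f : k[X]) (l : ι) :
    PowerSeries.coeff (n l) (PowerSeries.X * (invNodalCofactor v n l * (f : PowerSeries k))) =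
      ∑ s ∈ Finset.range (n l), partialFractionCoeff v n l s * f.coeff s := by
  rw [← mul_assoc, mul_comm, PowerSeries.coeff_mul, Finset.Nat.sum_antidiagonal_eq_sum_range_succ
    (fun s t => PowerSeries.coeff s (f : PowerSeries k) *
      PowerSeries.coeff t (PowerSeries.X * invNodalCofactor v n l)), Finset.sum_range_succ,
    Nat.sub_self, PowerSeries.coeff_zero_X_mul, mul_zero, add_zero]
  refine Finset.sum_congr rfl fun s hs => ?_
  rw [partialFractionCoeff, pow_succ, mul_assoc, PowerSeries.coeff_X_pow_mul',
    if_pos (Finset.mem_range.1 hs).le, coeff_coe, mul_comm]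

variable [CharZero k]

lemma factorial_mul_coeff_padePolynomial_mul_exp (l : ι) (i : ℕ) :
    (i.factorial : k) * PowerSeries.coeff i ((padePolynomial v n l : PowerSeries k) *
        PowerSeries.rescale (v l) (PowerSeries.exp k)) =
      PowerSeries.coeff (n l) (PowerSeries.X *
        (invNodalCofactor v n l * ((taylor (v l) (X ^ i) : k[X]) : PowerSeries k))) := by
  rw [coeff_X_mul_invNodalCofactor_mul, padePolynomial, ← coeToPowerSeries.ringHom_apply, map_sum,
    Finset.sum_mul, map_sum, Finset.mul_sum]
  refine Finset.sum_congr rfl fun s _ => ?_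
  rw [coeToPowerSeries.ringHom_apply, coe_monomial, PowerSeries.monomial_eq_C_mul_X_pow, mul_assoc,
    PowerSeries.coeff_C_mul, PowerSeries.coeff_X_pow_mul', taylor_pow, taylor_X, coeff_X_add_C_pow]
  split_ifs with hs
  · rw [PowerSeries.coeff_rescale, PowerSeries.coeff_exp, Nat.cast_choose k hs, map_div₀, map_one,
      map_natCast]
    ring
  · rw [Nat.choose_eq_zero_of_lt (not_le.1 hs)]
    simp

theorem X_pow_dvd_sum_padePolynomial_mul_exp {v : ι → k} (hv : Function.Injective v) (n : ι → ℕ) :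
    (PowerSeries.X : PowerSeries k) ^ (∑ m, n m - 1) ∣
      ∑ l, (padePolynomial v n l : PowerSeries k) *
        PowerSeries.rescale (v l) (PowerSeries.exp k) := by
  rw [PowerSeries.X_pow_dvd_iff]
  intro i hi
  have hfac : (i.factorial : k) ≠ 0 := Nat.cast_ne_zero.2 i.factorial_ne_zero
  rw [← mul_right_inj' hfac, mul_zero, map_sum, Finset.mul_sum]
  simp only [factorial_mul_coeff_padePolynomial_mul_exp]
  exact sum_coeff_invNodalCofactor_mul_taylor_eq_zero n hv (by rw [natDegree_X_pow]; omega)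

end HermitePade

section Determinants

variable {R κ : Type*} [CommRing R] [Fintype κ] [DecidableEq κ]

lemma coeff_det_of_natDegree_le {A : Matrix κ κ R[X]} {M : ℕ} (hA : ∀ i j, (A i j).natDegree ≤ M) :
    A.det.coeff (M * Fintype.card κ) = (A.map fun p => p.coeff M).det := by
  simp only [Matrix.det_apply, finsetSum_coeff, coeff_smul, Matrix.map_apply]
  refine Finset.sum_congr rfl fun σ _ => ?_
  rw [mul_comm, ← Finset.card_univ]
  exact congrArg _ (coeff_prod_of_natDegree_le Finset.univ _ M fun i _ => hA _ _)

lemma natDegree_det_le_of_natDegree_le {A : Matrix κ κ R[X]} {M : ℕ}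
    (hA : ∀ i j, (A i j).natDegree ≤ M) : A.det.natDegree ≤ M * Fintype.card κ := by
  rw [Matrix.det_apply]
  refine natDegree_sum_le_of_forall_le _ _ fun σ _ => (natDegree_smul_le _ _).trans ?_
  refine (natDegree_prod_le _ _).trans ((Finset.sum_le_sum fun i _ => hA _ _).trans_eq ?_)
  simp [mul_comm]

lemma dvd_det_of_forall_dvd_mulVec {A : Matrix κ κ R} {e : κ → R} {a : R}
    (h : ∀ i, a ∣ A.mulVec e i) {j : κ} (hj : IsUnit (e j)) : a ∣ A.det := by
  have hadj : A.det * e j = A.adjugate.mulVec (A.mulVec e) j := by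
    rw [Matrix.mulVec_mulVec, Matrix.adjugate_mul, Matrix.smul_mulVec, Matrix.one_mulVec,
      Pi.smul_apply, smul_eq_mul]
  rw [← hj.dvd_mul_right, hadj, Matrix.mulVec, dotProduct]
  exact Finset.dvd_sum fun i _ => (h i).mul_left _

lemma eq_C_mul_X_pow_of_X_pow_dvd {p : R[X]} {N : ℕ} (hdeg : p.natDegree ≤ N)
    (hdvd : X ^ N ∣ p) : p = C (p.coeff N) * X ^ N := by
  ext i
  rw [coeff_C_mul_X_pow]
  split_ifs with h
  · rw [h]
  · rcases lt_or_gt_of_ne h with h | h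
    · exact X_pow_dvd_iff.1 hdvd i h
    · exact coeff_eq_zero_of_natDegree_lt (hdeg.trans_lt h)

end Determinants

section PadeMatrix

variable {k ι : Type*} [Field k] [DecidableEq ι]

/-- The exponents `M, …, M, M + 1, M, …, M`, with `M + 1` in position `j`. -/
def padeExponent (M : ℕ) (j : ι) : ι → ℕ := (fun _ => M) + Pi.single j 1

@[simp] lemma padeExponent_self (M : ℕ) (j : ι) : padeExponent M j j = M + 1 := by
  simp [padeExponent]

lemma padeExponent_of_ne (M : ℕ) {j l : ι} (h : l ≠ j) : padeExponent M j l = M := by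
  simp [padeExponent, h]

lemma padeExponent_le (M : ℕ) (j l : ι) : padeExponent M j l ≤ M + 1 := by
  by_cases h : l = j
  · rw [h, padeExponent_self]
  · rw [padeExponent_of_ne M h]
    exact M.le_succ

variable [Fintype ι]

lemma sum_padeExponent (M : ℕ) (j : ι) : ∑ m, padeExponent M j m = M * Fintype.card ι + 1 := by
  simp [padeExponent, Finset.sum_add_distrib, mul_comm]

/-- The matrix whose rows are the Hermite–Padé forms for the series `exp (v l * X)` of the types
`padeExponent M j`. -/
noncomputable def padeMatrix (v : ι → k) (M : ℕ) : Matrix ι ι k[X] :=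
  Matrix.of fun j l => padePolynomial v (padeExponent M j) l

lemma natDegree_padeMatrix_le (v : ι → k) (M : ℕ) (j l : ι) :
    (padeMatrix v M j l).natDegree ≤ M :=
  natDegree_padePolynomial_le v (padeExponent_le M j l)

variable [CharZero k] {v : ι → k}

lemma coeff_det_padeMatrix_ne_zero (hv : Function.Injective v) (M : ℕ) :
    (padeMatrix v M).det.coeff (M * Fintype.card ι) ≠ 0 := by
  have hdiag : (padeMatrix v M).map (fun p => p.coeff M) =
      Matrix.diagonal fun j => (padePolynomial v (padeExponent M j) j).coeff M := by
    ext j l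
    rcases eq_or_ne j l with rfl | h
    · simp [padeMatrix]
    · rw [Matrix.diagonal_apply_ne _ h, Matrix.map_apply, padeMatrix, Matrix.of_apply,
        coeff_padePolynomial, partialFractionCoeff_eq_zero v (padeExponent_of_ne M h.symm).le,
        zero_div]
  rw [coeff_det_of_natDegree_le (natDegree_padeMatrix_le v M), hdiag, Matrix.det_diagonal]
  exact Finset.prod_ne_zero_iff.2 fun j _ =>
    coeff_padePolynomial_ne_zero hv (padeExponent_self M j)

lemma X_pow_dvd_det_padeMatrix [Nonempty ι] (hv : Function.Injective v) (M : ℕ) :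
    X ^ (M * Fintype.card ι) ∣ (padeMatrix v M).det := by
  have hseries : PowerSeries.X ^ (M * Fintype.card ι) ∣
      ((padeMatrix v M).map (coeToPowerSeries.ringHom (R := k))).det := by
    refine dvd_det_of_forall_dvd_mulVec (j := Classical.arbitrary ι)
      (e := fun l => PowerSeries.rescale (v l) (PowerSeries.exp k)) (fun j => ?_) ?_
    · have h := X_pow_dvd_sum_padePolynomial_mul_exp hv (padeExponent M j)
      rwa [sum_padeExponent, Nat.add_sub_cancel] at h
    · rw [PowerSeries.isUnit_iff_constantCoeff, ← PowerSeries.coeff_zero_eq_constantCoeff_apply]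
      simp [PowerSeries.coeff_rescale]
  rw [← RingHom.mapMatrix_apply, ← RingHom.map_det, PowerSeries.X_pow_dvd_iff] at hseries
  exact X_pow_dvd_iff.2 fun i hi => by simpa using hseries i hi

theorem exists_ne_zero_det_padeMatrix_eq [Nonempty ι] (hv : Function.Injective v) (M : ℕ) :
    ∃ c : k, c ≠ 0 ∧ (padeMatrix v M).det = C c * X ^ (M * Fintype.card ι) :=
  ⟨_, coeff_det_padeMatrix_ne_zero hv M, eq_C_mul_X_pow_of_X_pow_dvd
    (natDegree_det_le_of_natDegree_le (natDegree_padeMatrix_le v M))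
    (X_pow_dvd_det_padeMatrix hv M)⟩

theorem exists_sum_aeval_padePolynomial_mul_ne_zero {K : Type*} [Field K] [Algebra k K]
    (hv : Function.Injective v) (M : ℕ) {β : K} (hβ : β ≠ 0) {w : ι → K} (hw : w ≠ 0) :
    ∃ j, ∑ l, aeval β (padePolynomial v (padeExponent M j) l) * w l ≠ 0 := by
  obtain ⟨l, -⟩ := Function.ne_iff.1 hw
  have : Nonempty ι := ⟨l⟩
  obtain ⟨c, hc, hdet⟩ := exists_ne_zero_det_padeMatrix_eq hv M
  by_contra! hzero
  have hsing : ((aeval β : k[X] →ₐ[k] K).mapMatrix (padeMatrix v M)).det = 0 :=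
    Matrix.exists_mulVec_eq_zero_iff.1 ⟨w, hw, funext hzero⟩
  rw [← AlgHom.map_det, hdet] at hsing
  simp [hc, hβ] at hsing

end PadeMatrix

section PrimeParts

/-- The largest divisor of `a` without prime factors greater than `n`. -/
def smallPrimePart (n a : ℕ) : ℕ :=
  ∏ q ∈ (Finset.Icc 1 n).filter Nat.Prime, q ^ padicValNat q a

/-- The largest divisor of `a` without prime factors up to `n`. -/
def largePrimePart (n a : ℕ) : ℕ := ∏ q ∈ a.primeFactors.filter (n < ·), q ^ padicValNat q a

lemma smallPrimePart_mul_largePrimePart (n : ℕ) {a : ℕ} (ha : a ≠ 0) :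
    smallPrimePart n a * largePrimePart n a = a := by
  have hsmall : smallPrimePart n a =
      ∏ q ∈ a.primeFactors.filter (¬ n < ·), q ^ padicValNat q a := by
    refine (Finset.prod_subset (fun q hq => ?_) fun q hq hqa => ?_).symm
    · obtain ⟨hqa, hqn⟩ := Finset.mem_filter.1 hq
      have hprime := Nat.prime_of_mem_primeFactors hqa
      exact Finset.mem_filter.2 ⟨Finset.mem_Icc.2 ⟨hprime.one_le, not_lt.1 hqn⟩, hprime⟩
    · obtain ⟨hqn, hprime⟩ := Finset.mem_filter.1 hq
      have hdvd : ¬ q ∣ a := fun h => hqa (Finset.mem_filter.2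
        ⟨hprime.mem_primeFactors h ha, not_lt.2 (Finset.mem_Icc.1 hqn).2⟩)
      rw [padicValNat.eq_zero_of_not_dvd hdvd, pow_zero]
  rw [hsmall, largePrimePart, mul_comm, Finset.prod_filter_mul_prod_filter_not]
  conv_rhs => rw [← Nat.prod_factorization_pow_eq_self ha, Finsupp.prod, Nat.support_factorization]
  exact Finset.prod_congr rfl fun q hq => by
    rw [Nat.factorization_def a (Nat.prime_of_mem_primeFactors hq)]

lemma largePrimePart_dvd_largePrimePart (n : ℕ) {a b : ℕ} (hb : b ≠ 0) (hab : a ∣ b) :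
    largePrimePart n a ∣ largePrimePart n b := by
  refine (Finset.prod_dvd_prod_of_dvd _ (fun q => q ^ padicValNat q b) fun q hq => ?_).trans
    (Finset.prod_dvd_prod_of_subset _ _ _
      (Finset.filter_subset_filter _ (Nat.primeFactors_mono hab hb)))
  have := Fact.mk (Nat.prime_of_mem_primeFactors (Finset.mem_filter.1 hq).1)
  exact pow_dvd_pow q ((padicValNat_dvd_iff_le hb).1 (pow_padicValNat_dvd.trans hab))

lemma smallPrimePart_factorial_dvd (n s : ℕ) :
    smallPrimePart n s.factorial ∣ lcmUpTo n ^ s := by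
  calc smallPrimePart n s.factorial
      ∣ ∏ q ∈ (Finset.Icc 1 n).filter Nat.Prime, q ^ s := by
        refine Finset.prod_dvd_prod_of_dvd _ _ fun q hq => pow_dvd_pow _ ?_
        have := Fact.mk (Finset.mem_filter.1 hq).2
        exact padicValNat_factorial_le q s
    _ = (∏ q ∈ (Finset.Icc 1 n).filter Nat.Prime, q) ^ s := Finset.prod_pow _ _ _
    _ ∣ lcmUpTo n ^ s := pow_dvd_pow_of_dvd (Finset.prod_primes_dvd _
        (fun q hq => (Finset.mem_filter.1 hq).2.prime)
        fun q hq => Finset.dvd_lcm (f := id) (Finset.mem_filter.1 hq).1) s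

lemma factorial_dvd_lcmUpTo_pow_mul_largePrimePart (n : ℕ) {s m : ℕ} (hs : s ≤ m) :
    s.factorial ∣ lcmUpTo n ^ s * largePrimePart n m.factorial := by
  nth_rw 1 [← smallPrimePart_mul_largePrimePart n s.factorial_ne_zero]
  exact mul_dvd_mul (smallPrimePart_factorial_dvd n s)
    (largePrimePart_dvd_largePrimePart n m.factorial_ne_zero (Nat.factorial_dvd_factorial hs))

lemma largePrimePart_pos (n a : ℕ) : 0 < largePrimePart n a :=
  Finset.prod_pos fun _ hq =>
    pow_pos (Nat.prime_of_mem_primeFactors (Finset.mem_filter.1 hq).1).pos _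

lemma factorialPart_eq_largePrimePart (m n : ℕ) :
    factorialPart m n = largePrimePart n m.factorial := by
  have hsplit := smallPrimePart_mul_largePrimePart n m.factorial_ne_zero
  have hne : (smallPrimePart n m.factorial : ℝ) ≠ 0 :=
    Nat.cast_ne_zero.2 (left_ne_zero_of_mul (hsplit.trans_ne m.factorial_ne_zero))
  have hdef : factorialPart m n = m.factorial / smallPrimePart n m.factorial := by
    simp [factorialPart, smallPrimePart]
  rw [hdef, div_eq_iff hne, mul_comm]
  exact_mod_cast hsplit.symm

lemma lcmUpTo_pos (n : ℕ) : 0 < lcmUpTo n := Nat.lcmUpto_pos n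

lemma intCast_dvd_lcmUpTo {n : ℕ} {a : ℤ} (ha : a ≠ 0) (han : |a| ≤ n) :
    a ∣ (lcmUpTo n : ℤ) := by
  rw [Int.abs_eq_natAbs] at han
  rw [← Int.natAbs_dvd_natAbs, Int.natAbs_natCast]
  have hmem : a.natAbs ∈ Finset.Icc 1 n := Finset.mem_Icc.2 ⟨by omega, by omega⟩
  exact Finset.dvd_lcm (f := id) hmem

end PrimeParts

section WeightedBounds

variable {R : Type*} [NormedCommRing R] {f g : PowerSeries R} {r A B : ℝ}

/-- `B` bounds the `ℓ¹`-norm of the coefficients of `f`, weighted by the powers of `r`. -/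
def HasWeightedBound (r : ℝ) (f : PowerSeries R) (B : ℝ) : Prop :=
  ∀ N, ∑ i ∈ Finset.range N, ‖PowerSeries.coeff i f‖ * r ^ i ≤ B

namespace HasWeightedBound

lemma nonneg (hf : HasWeightedBound r f B) : 0 ≤ B := by simpa using hf 0

lemma mono (hf : HasWeightedBound r f A) (hAB : A ≤ B) : HasWeightedBound r f B :=
  fun N => (hf N).trans hAB

protected lemma mul (hr : 0 ≤ r) (hf : HasWeightedBound r f A) (hg : HasWeightedBound r g B) :
    HasWeightedBound r (f * g) (A * B) := by
  intro N
  set a : ℕ → ℝ := fun i => ‖PowerSeries.coeff i f‖ * r ^ i with ha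
  set b : ℕ → ℝ := fun i => ‖PowerSeries.coeff i g‖ * r ^ i with hb
  have hterm (i : ℕ) : ‖PowerSeries.coeff i (f * g)‖ * r ^ i ≤
      ∑ k ∈ Finset.range (i + 1), a k * b (i - k) := by
    rw [PowerSeries.coeff_mul, ← Finset.Nat.sum_antidiagonal_eq_sum_range_succ fun k m => a k * b m]
    refine (mul_le_mul_of_nonneg_right (norm_sum_le _ _) (pow_nonneg hr i)).trans ?_
    rw [Finset.sum_mul]
    refine Finset.sum_le_sum fun p hp => ?_
    rw [← Finset.HasAntidiagonal.mem_antidiagonal.1 hp, pow_add, ha, hb, mul_mul_mul_comm]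
    gcongr
    exact norm_mul_le _ _
  calc ∑ i ∈ Finset.range N, ‖PowerSeries.coeff i (f * g)‖ * r ^ i
      ≤ ∑ i ∈ Finset.range N, ∑ k ∈ Finset.range (i + 1), a k * b (i - k) :=
        Finset.sum_le_sum fun i _ => hterm i
    _ = ∑ k ∈ Finset.range N, ∑ m ∈ Finset.range (N - k), a k * b m :=
        Finset.sum_range_diag_flip N fun k m => a k * b m
    _ ≤ ∑ k ∈ Finset.range N, a k * B := by
        refine Finset.sum_le_sum fun k _ => ?_
        rw [← Finset.mul_sum]
        exact mul_le_mul_of_nonneg_left (hg _) (by positivity)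
    _ ≤ A * B := by
        rw [← Finset.sum_mul]
        exact mul_le_mul_of_nonneg_right (hf N) hg.nonneg

lemma sum_norm_coeff_X_pow_mul_le (hr : 0 < r) (hr1 : r ≤ 1) (hf : HasWeightedBound r f B)
    {n M : ℕ} (hn : n ≤ M + 1) :
    ∑ s ∈ Finset.range n, ‖PowerSeries.coeff n (PowerSeries.X ^ (s + 1) * f)‖ ≤ r⁻¹ ^ M * B := by
  have hshift : ∑ s ∈ Finset.range n, ‖PowerSeries.coeff n (PowerSeries.X ^ (s + 1) * f)‖ =
      ∑ i ∈ Finset.range n, ‖PowerSeries.coeff i f‖ := by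
    rw [← Finset.sum_range_reflect]
    refine Finset.sum_congr rfl fun s hs => ?_
    have := Finset.mem_range.1 hs
    rw [PowerSeries.coeff_X_pow_mul', if_pos (by omega), show n - (n - 1 - s + 1) = s by omega]
  rw [hshift]
  refine le_trans ?_ (mul_le_mul_of_nonneg_left (hf n) (by positivity))
  rw [Finset.mul_sum]
  refine Finset.sum_le_sum fun i hi => ?_
  have hiM : i ≤ M := by
    have := Finset.mem_range.1 hi
    omega
  have hweight : 1 ≤ r⁻¹ ^ M * r ^ i := by
    rw [inv_pow, inv_mul_eq_div, one_le_div (by positivity)]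
    exact pow_le_pow_of_le_one hr.le hr1 hiM
  rw [mul_left_comm]
  exact le_mul_of_one_le_right (norm_nonneg _) hweight

variable [NormOneClass R]

protected lemma one : HasWeightedBound r (1 : PowerSeries R) 1 := by
  rintro (_ | N)
  · simp
  · simp [Finset.sum_range_succ', PowerSeries.coeff_one]

protected lemma pow (hr : 0 ≤ r) (hf : HasWeightedBound r f A) (n : ℕ) :
    HasWeightedBound r (f ^ n) (A ^ n) := by
  induction n with
  | zero => simpa only [pow_zero] using HasWeightedBound.one
  | succ n ih => simpa only [pow_succ] using ih.mul hr hf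

protected lemma prod {ι : Type*} (hr : 0 ≤ r) {s : Finset ι} {f : ι → PowerSeries R} {A : ι → ℝ}
    (h : ∀ i ∈ s, HasWeightedBound r (f i) (A i)) :
    HasWeightedBound r (∏ i ∈ s, f i) (∏ i ∈ s, A i) := by
  classical
  induction s using Finset.induction_on with
  | empty => simpa only [Finset.prod_empty] using HasWeightedBound.one
  | insert i s hi ih =>
    rw [Finset.prod_insert hi, Finset.prod_insert hi]
    exact (h i (Finset.mem_insert_self i s)).mul hr
      (ih fun m hm => h m (Finset.mem_insert_of_mem hm))

lemma mk_pow {c : R} (hr : 0 ≤ r) (hc : r * ‖c‖ < 1) :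
    HasWeightedBound r (PowerSeries.mk fun i => c ^ i) (1 - r * ‖c‖)⁻¹ := by
  intro N
  have hterm (i : ℕ) : ‖PowerSeries.coeff i (PowerSeries.mk fun i => c ^ i)‖ * r ^ i ≤
      (r * ‖c‖) ^ i := by
    rw [PowerSeries.coeff_mk, mul_pow, mul_comm]
    gcongr
    exact norm_pow_le c i
  have hnonneg : 0 ≤ r * ‖c‖ := by positivity
  rw [← tsum_geometric_of_lt_one hnonneg hc]
  exact (Finset.sum_le_sum fun i _ => hterm i).trans
    ((summable_geometric_of_lt_one hnonneg hc).sum_le_tsum _ fun i _ => pow_nonneg hnonneg i)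

end HasWeightedBound

end WeightedBounds

section PartialFractionCoefficients

variable {k ι : Type*} [Field k] [Fintype ι] [DecidableEq ι] (v : ι → k) (n : ι → ℕ)

/-- The expansion of the inverse of `nodalCofactor v n l` in powers of `X - v l`, normalised to have
constant term `1`: the product of the `(1 + (X - v l) / (v l - v m)) ^ (-n m)`. -/
noncomputable def normalizedInvNodalCofactor (l : ι) : PowerSeries k :=
  ∏ m ∈ Finset.univ.erase l, (PowerSeries.mk fun i => (-(v l - v m)⁻¹) ^ i) ^ n m

lemma inv_X_add_C_eq {a : k} (ha : a ≠ 0) :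
    (PowerSeries.X + PowerSeries.C a)⁻¹ =
      PowerSeries.C a⁻¹ * PowerSeries.mk fun i => (-a⁻¹) ^ i := by
  rw [PowerSeries.inv_eq_iff_mul_eq_one (constantCoeff_X_add_C_ne_zero ha)]
  ext (_ | i)
  · simp [ha]
  · rw [mul_assoc, PowerSeries.coeff_C_mul, mul_add, map_add, PowerSeries.coeff_succ_mul_X,
      PowerSeries.coeff_mul_C, PowerSeries.coeff_mk, PowerSeries.coeff_mk,
      PowerSeries.coeff_one, if_neg i.succ_ne_zero, pow_succ]
    field_simp
    ring

variable {v}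

lemma invNodalCofactor_eq (hv : Function.Injective v) (l : ι) :
    invNodalCofactor v n l =
      PowerSeries.C (∏ m ∈ Finset.univ.erase l, (v l - v m)⁻¹ ^ n m) *
        normalizedInvNodalCofactor v n l := by
  rw [invNodalCofactor, normalizedInvNodalCofactor, map_prod, ← Finset.prod_mul_distrib]
  refine Finset.prod_congr rfl fun m hm => ?_
  rw [inv_X_add_C_eq (sub_ne_zero.2 (hv.ne (Finset.ne_of_mem_erase hm).symm)), mul_pow, map_pow]

lemma prod_erase_pow_padeExponent {G : Type*} [CommMonoid G] (f : ι → G) (M : ℕ) (j l : ι) :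
    ∏ m ∈ Finset.univ.erase l, f m ^ padeExponent M j m =
      (∏ m ∈ Finset.univ.erase l, f m) ^ M * if l = j then 1 else f j := by
  have hsplit (m : ι) : f m ^ padeExponent M j m = f m ^ M * if j = m then f m else 1 := by
    rcases eq_or_ne j m with rfl | h
    · rw [padeExponent_self, if_pos rfl, pow_succ]
    · rw [padeExponent_of_ne M h.symm, if_neg h, mul_one]
  simp only [hsplit, Finset.prod_mul_distrib, Finset.prod_pow, Finset.prod_ite_eq,
    Finset.mem_erase, Finset.mem_univ, and_true, ne_comm (a := j), ite_not, ne_eq]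

lemma pow_mul_partialFractionCoeff (hv : Function.Injective v) (w : k) (M : ℕ) (j l : ι) (s : ℕ) :
    w ^ M * partialFractionCoeff v (padeExponent M j) l s =
      (w * Lagrange.nodalWeight Finset.univ v l) ^ M * (if l = j then 1 else (v l - v j)⁻¹) *
        PowerSeries.coeff (padeExponent M j l)
          (PowerSeries.X ^ (s + 1) * normalizedInvNodalCofactor v (padeExponent M j) l) := by
  rw [partialFractionCoeff, invNodalCofactor_eq _ hv,
    prod_erase_pow_padeExponent (fun m => (v l - v m)⁻¹), mul_left_comm, PowerSeries.coeff_C_mul,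
    Lagrange.nodalWeight]
  ring

end PartialFractionCoefficients

section PadeIntegrality

variable {k ι : Type*} [Field k] [Fintype ι] [DecidableEq ι] {v : ι → k} {S : Subring k} {d : k}
  {l : ι}

lemma pow_mul_coeff_normalizedInvNodalCofactor_mem (hd : ∀ m ≠ l, d * (v l - v m)⁻¹ ∈ S)
    (n : ι → ℕ) (i : ℕ) :
    d ^ i * PowerSeries.coeff i (normalizedInvNodalCofactor v n l) ∈ S := by
  have hmem : PowerSeries.rescale d (normalizedInvNodalCofactor v n l) ∈
      (PowerSeries.map S.subtype).range := by
    rw [normalizedInvNodalCofactor, map_prod]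
    refine Subring.prod_mem _ fun m hm => ?_
    rw [map_pow]
    refine Subring.pow_mem _ ?_ _
    have hc : d * -(v l - v m)⁻¹ ∈ S := by
      simpa only [mul_neg] using S.neg_mem (hd m (Finset.ne_of_mem_erase hm))
    exact ⟨PowerSeries.mk fun i => ⟨_, hc⟩ ^ i, by
      ext i
      simp [PowerSeries.coeff_rescale, ← mul_pow]⟩
  obtain ⟨g, hg⟩ := hmem
  rw [← PowerSeries.coeff_rescale, ← hg, PowerSeries.coeff_map]
  exact (PowerSeries.coeff i g).2

lemma pow_sub_mul_partialFractionCoeff_mem (hv : Function.Injective v)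
    (hd : ∀ m ≠ l, d * (v l - v m)⁻¹ ∈ S) {w : k}
    (hw : w * Lagrange.nodalWeight Finset.univ v l ∈ S) (M : ℕ) (j : ι) (s : ℕ) :
    d ^ (M - s) * (w ^ M * partialFractionCoeff v (padeExponent M j) l s) ∈ S := by
  rw [pow_mul_partialFractionCoeff hv, mul_assoc, mul_left_comm]
  refine S.mul_mem (S.pow_mem hw M) ?_
  set F := normalizedInvNodalCofactor v (padeExponent M j) l
  rw [PowerSeries.coeff_X_pow_mul']
  rcases eq_or_ne l j with hlj | hlj
  · rw [if_pos hlj, one_mul, hlj, padeExponent_self, Nat.add_sub_add_right]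
    split_ifs
    · exact pow_mul_coeff_normalizedInvNodalCofactor_mem hd _ _
    · simp only [mul_zero, S.zero_mem]
  · rw [if_neg hlj, padeExponent_of_ne M hlj]
    split_ifs with hs
    · have hsplit : d ^ (M - s) * ((v l - v j)⁻¹ * PowerSeries.coeff (M - (s + 1)) F) =
          d * (v l - v j)⁻¹ * (d ^ (M - (s + 1)) * PowerSeries.coeff (M - (s + 1)) F) := by
        rw [show M - s = M - (s + 1) + 1 by omega]
        ring
      rw [hsplit]
      exact S.mul_mem (hd j hlj.symm) (pow_mul_coeff_normalizedInvNodalCofactor_mem hd _ _)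
    · simp only [mul_zero, S.zero_mem]

lemma mul_coeff_padePolynomial_mem (hv : Function.Injective v)
    (hd : ∀ m ≠ l, d * (v l - v m)⁻¹ ∈ S) {w : k}
    (hw : w * Lagrange.nodalWeight Finset.univ v l ∈ S) {M : ℕ} {b : k}
    (hb : ∀ s ≤ M, d ^ s * b / s.factorial ∈ S) (j : ι) (s : ℕ) :
    d ^ M * b * w ^ M * (padePolynomial v (padeExponent M j) l).coeff s ∈ S := by
  rw [coeff_padePolynomial]
  rcases le_or_gt s M with hs | hs
  · have hmem := S.mul_mem (pow_sub_mul_partialFractionCoeff_mem hv hd hw M j s) (hb s hs)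
    convert hmem using 1
    rw [← Nat.sub_add_cancel hs, pow_add, Nat.sub_add_cancel hs]
    ring
  · rw [partialFractionCoeff_eq_zero v ((padeExponent_le M j l).trans hs), zero_div, mul_zero]
    exact S.zero_mem

end PadeIntegrality

section PadeSize

variable {k ι : Type*} [NormedField k] [Fintype ι] [DecidableEq ι] {v : ι → k} {r : ℝ} {l : ι}

lemma hasWeightedBound_normalizedInvNodalCofactor (hr : 0 ≤ r)
    (hsep : ∀ m ≠ l, r * ‖(v l - v m)⁻¹‖ < 1) (n : ι → ℕ) :
    HasWeightedBound r (normalizedInvNodalCofactor v n l)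
      (∏ m ∈ Finset.univ.erase l, (1 - r * ‖(v l - v m)⁻¹‖)⁻¹ ^ n m) :=
  HasWeightedBound.prod hr fun m hm => by
    have hc : r * ‖-(v l - v m)⁻¹‖ < 1 := by
      simpa only [norm_neg] using hsep m (Finset.ne_of_mem_erase hm)
    simpa only [norm_neg] using (HasWeightedBound.mk_pow hr hc).pow hr (n m)

lemma mul_norm_inv_le (hr : 0 ≤ r) {x : k} (hx : 1 ≤ ‖x‖) : r * ‖x⁻¹‖ ≤ r := by
  rw [norm_inv]
  exact mul_le_of_le_one_right hr (inv_le_one_of_one_le₀ hx)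

lemma prod_inv_one_sub_mul_norm_inv_nonneg (hr : 0 ≤ r) (hr1 : r ≤ 1)
    (hsep : ∀ m ≠ l, 1 ≤ ‖v l - v m‖) :
    0 ≤ ∏ m ∈ Finset.univ.erase l, (1 - r * ‖(v l - v m)⁻¹‖)⁻¹ :=
  Finset.prod_nonneg fun m hm => inv_nonneg.2 (sub_nonneg.2
    ((mul_norm_inv_le hr (hsep m (Finset.ne_of_mem_erase hm))).trans hr1))

lemma hasWeightedBound_normalizedInvNodalCofactor_padeExponent (hr : 0 ≤ r) (hr1 : r < 1)
    (hsep : ∀ m ≠ l, 1 ≤ ‖v l - v m‖) (M : ℕ) (j : ι) :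
    HasWeightedBound r (normalizedInvNodalCofactor v (padeExponent M j) l)
      ((∏ m ∈ Finset.univ.erase l, (1 - r * ‖(v l - v m)⁻¹‖)⁻¹) ^ M * (1 - r)⁻¹) := by
  refine (hasWeightedBound_normalizedInvNodalCofactor hr
    (fun m hm => (mul_norm_inv_le hr (hsep m hm)).trans_lt hr1) _).mono ?_
  rw [prod_erase_pow_padeExponent fun m => (1 - r * ‖(v l - v m)⁻¹‖)⁻¹]
  refine mul_le_mul_of_nonneg_left ?_ (pow_nonneg
    (prod_inv_one_sub_mul_norm_inv_nonneg hr hr1.le hsep) M)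
  split_ifs with hlj
  · exact (one_le_inv₀ (sub_pos.2 hr1)).2 (sub_le_self 1 hr)
  · exact inv_anti₀ (sub_pos.2 hr1) (sub_le_sub_left
      (mul_norm_inv_le hr (hsep j (Ne.symm hlj))) 1)

lemma sum_norm_pow_mul_partialFractionCoeff_le (hv : Function.Injective v) (hr : 0 < r)
    (hr1 : r < 1) (hsep : ∀ m ≠ l, 1 ≤ ‖v l - v m‖) (w : k) (M : ℕ) (j : ι) :
    ∑ s ∈ Finset.range (padeExponent M j l),
        ‖w ^ M * partialFractionCoeff v (padeExponent M j) l s‖ ≤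
      (‖w * Lagrange.nodalWeight Finset.univ v l‖ * r⁻¹ *
        ∏ m ∈ Finset.univ.erase l, (1 - r * ‖(v l - v m)⁻¹‖)⁻¹) ^ M * (1 - r)⁻¹ := by
  have hnorm : ‖if l = j then 1 else (v l - v j)⁻¹‖ ≤ 1 := by
    split_ifs with hlj
    · exact norm_one.le
    · rw [norm_inv]
      exact inv_le_one_of_one_le₀ (hsep j (Ne.symm hlj))
  have hterm (s : ℕ) : ‖w ^ M * partialFractionCoeff v (padeExponent M j) l s‖ ≤
      ‖w * Lagrange.nodalWeight Finset.univ v l‖ ^ M *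
        ‖PowerSeries.coeff (padeExponent M j l)
          (PowerSeries.X ^ (s + 1) * normalizedInvNodalCofactor v (padeExponent M j) l)‖ := by
    rw [pow_mul_partialFractionCoeff hv, norm_mul, norm_mul, norm_pow]
    exact mul_le_mul_of_nonneg_right (mul_le_of_le_one_right (by positivity) hnorm)
      (norm_nonneg _)
  refine (Finset.sum_le_sum fun s _ => hterm s).trans ?_
  rw [← Finset.mul_sum, mul_pow, mul_pow, mul_assoc, mul_assoc]
  exact mul_le_mul_of_nonneg_left ((hasWeightedBound_normalizedInvNodalCofactor_padeExponent hr.le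
    hr1 hsep M j).sum_norm_coeff_X_pow_mul_le hr hr1.le (padeExponent_le M j l)) (by positivity)

end PadeSize

section NaturalNodes

/-- The interpolation nodes `0, …, L - 1`. -/
def natNode (L : ℕ) (l : Fin L) : ℚ := (l : ℕ)

lemma natNode_injective (L : ℕ) : Function.Injective (natNode L) := fun _ _ h =>
  Fin.ext (Nat.cast_injective h)

lemma natNode_sub {L : ℕ} (l m : Fin L) :
    natNode L l - natNode L m = (((l : ℕ) : ℤ) - ((m : ℕ) : ℤ) : ℤ) := by
  simp [natNode]

lemma natNode_sub_ne_zero {L : ℕ} {l m : Fin L} (h : m ≠ l) :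
    ((l : ℕ) : ℤ) - ((m : ℕ) : ℤ) ≠ 0 :=
  sub_ne_zero.2 fun hlm => h (Fin.ext (Nat.cast_injective hlm)).symm

lemma one_le_norm_natNode_sub {L : ℕ} {l m : Fin L} (h : m ≠ l) :
    1 ≤ ‖natNode L l - natNode L m‖ := by
  rw [natNode_sub, Int.norm_cast_rat, Int.norm_eq_abs]
  exact_mod_cast Int.one_le_abs (natNode_sub_ne_zero h)

lemma lcmUpTo_mul_inv_natNode_sub_mem {L : ℕ} {l m : Fin L} (h : m ≠ l) :
    (lcmUpTo (L - 1) : ℚ) * (natNode L l - natNode L m)⁻¹ ∈ (Int.castRingHom ℚ).range := by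
  have hne := natNode_sub_ne_zero h
  obtain ⟨a, ha⟩ := intCast_dvd_lcmUpTo (n := L - 1) hne (by rw [abs_le]; omega)
  refine ⟨a, ?_⟩
  rw [eq_intCast, natNode_sub, ← Int.cast_natCast, ha, Int.cast_mul, mul_comm,
    inv_mul_cancel_left₀ (by exact_mod_cast hne)]

lemma prod_univ_erase_sub {G : Type*} [CommMonoid G] {L : ℕ} (l : Fin L) (f : ℤ → G) :
    ∏ m ∈ Finset.univ.erase l, f (((l : ℕ) : ℤ) - ((m : ℕ) : ℤ)) =
      (∏ i ∈ Finset.range l, f (i + 1)) * ∏ i ∈ Finset.range (L - 1 - l), f (-(i + 1)) := by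
  set g : ℕ → G := Function.update (fun m => f (((l : ℕ) : ℤ) - m)) l 1 with hg
  have hL : L = l + 1 + (L - 1 - l) := by omega
  calc ∏ m ∈ Finset.univ.erase l, f (((l : ℕ) : ℤ) - ((m : ℕ) : ℤ))
      = ∏ m ∈ Finset.univ.erase l, g m := Finset.prod_congr rfl fun m hm => by
        rw [hg, Function.update_of_ne (Fin.val_ne_of_ne (Finset.ne_of_mem_erase hm))]
    _ = ∏ m ∈ Finset.range (l + 1 + (L - 1 - l)), g m := by
        rw [Finset.prod_erase (f := fun m : Fin L => g m) _ (Function.update_self ..),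
          Fin.prod_univ_eq_prod_range g L, ← hL]
    _ = (∏ m ∈ Finset.range l, f (((l : ℕ) : ℤ) - m)) *
          ∏ i ∈ Finset.range (L - 1 - l), f (((l : ℕ) : ℤ) - (l + 1 + i : ℕ)) := by
        rw [Finset.prod_range_add, Finset.prod_range_succ, hg, Function.update_self, mul_one]
        congr 1 <;> refine Finset.prod_congr rfl fun i hi => ?_
        · rw [Function.update_of_ne (Finset.mem_range.1 hi).ne]
        · rw [Function.update_of_ne (by omega)]
    _ = _ := by
        congr 1
        · rw [← Finset.prod_range_reflect]
          refine Finset.prod_congr rfl fun i hi => congrArg f ?_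
          have := Finset.mem_range.1 hi
          omega
        · exact Finset.prod_congr rfl fun i _ => congrArg f (by omega)

lemma factorial_mul_nodalWeight_natNode {L : ℕ} (l : Fin L) :
    ((L - 1).factorial : ℚ) * Lagrange.nodalWeight Finset.univ (natNode L) l =
      ((-1) ^ (L - 1 - l : ℕ) * (L - 1).choose l : ℤ) := by
  have hweight : Lagrange.nodalWeight Finset.univ (natNode L) l =
      (((l : ℕ).factorial : ℚ) * ((-1) ^ (L - 1 - l : ℕ) * (L - 1 - l : ℕ).factorial))⁻¹ := by
    simp only [Lagrange.nodalWeight, natNode_sub]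
    rw [prod_univ_erase_sub l fun a : ℤ => (a : ℚ)⁻¹, Finset.prod_inv_distrib,
      Finset.prod_inv_distrib, ← mul_inv, ← Finset.prod_range_add_one_eq_factorial,
      ← Finset.prod_range_add_one_eq_factorial]
    simp only [Int.cast_neg, Finset.prod_neg, Finset.card_range]
    push_cast
    rfl
  rw [hweight]
  push_cast
  rw [Nat.cast_choose ℚ (by omega : (l : ℕ) ≤ L - 1), mul_inv, mul_inv, ← inv_pow, inv_neg_one]
  ring

lemma norm_factorial_mul_nodalWeight_natNode_le {L : ℕ} (hL : 2 ≤ L) (l : Fin L) :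
    ‖((L - 1).factorial : ℚ) * Lagrange.nodalWeight Finset.univ (natNode L) l‖ ≤ 2 ^ (L - 2) := by
  have hchoose := Nat.choose_succ_le_two_pow (L - 2) l
  rw [show L - 2 + 1 = L - 1 by omega] at hchoose
  rw [factorial_mul_nodalWeight_natNode, Int.norm_cast_rat, Int.norm_eq_abs]
  push_cast
  rw [abs_mul, abs_pow, abs_neg, abs_one, one_pow, one_mul, Nat.abs_cast]
  exact_mod_cast hchoose

/-- The product grows like `a ^ (1 / 4)`, whence the fourth power. -/
lemma prod_inv_one_sub_inv_pow_four_le (a : ℕ) :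
    (∏ i ∈ Finset.range a, (1 - 1 / 4 * ((i : ℝ) + 1)⁻¹)⁻¹) ^ 4 ≤ 1 + 3 * a := by
  induction a with
  | zero => simp
  | succ a ih =>
    have hfactor : (1 - 1 / 4 * ((a : ℝ) + 1)⁻¹)⁻¹ = 4 * (a + 1) / (4 * a + 3) := by
      rw [inv_eq_iff_eq_inv, inv_div]
      field_simp
      ring
    rw [Finset.prod_range_succ, mul_pow, hfactor]
    calc _ ≤ (1 + 3 * (a : ℝ)) * (4 * (a + 1) / (4 * a + 3)) ^ 4 := by gcongr
      _ ≤ 1 + 3 * ((a + 1 : ℕ) : ℝ) := by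
        rw [div_pow, ← mul_div_assoc, div_le_iff₀ (by positivity)]
        have hdiff : 0 ≤ 32 * (a : ℝ) ^ 3 + 144 * a ^ 2 + 179 * a + 68 := by positivity
        push_cast
        linarith

lemma prod_inv_one_sub_inv_norm_natNode_sub_le {L : ℕ} (l : Fin L) :
    ∏ m ∈ Finset.univ.erase l, (1 - 1 / 4 * ‖(natNode L l - natNode L m)⁻¹‖)⁻¹ ≤ √(3 * L) := by
  set G : ℕ → ℝ := fun a => ∏ i ∈ Finset.range a, (1 - 1 / 4 * ((i : ℝ) + 1)⁻¹)⁻¹ with hG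
  have hprod : ∏ m ∈ Finset.univ.erase l, (1 - 1 / 4 * ‖(natNode L l - natNode L m)⁻¹‖)⁻¹ =
      G l * G (L - 1 - l) := by
    have habs (i : ℕ) : |(i : ℝ) + 1| = i + 1 := abs_of_nonneg (by positivity)
    simp only [natNode_sub, norm_inv, Int.norm_cast_rat, Int.norm_eq_abs]
    rw [prod_univ_erase_sub l fun a : ℤ => (1 - 1 / 4 * |(a : ℝ)|⁻¹)⁻¹]
    push_cast
    simp only [abs_neg, habs, hG]
  have hl : (0 : ℝ) ≤ (l : ℕ) := by positivity
  have hr : (0 : ℝ) ≤ (L - 1 - l : ℕ) := by positivity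
  have hL : (L : ℝ) = (l : ℕ) + 1 + (L - 1 - l : ℕ) := by
    exact_mod_cast (by omega : L = l + 1 + (L - 1 - l))
  have hpow : (G l * G (L - 1 - l)) ^ 4 ≤ (3 * L) ^ 2 := by
    calc (G l * G (L - 1 - l)) ^ 4 = G l ^ 4 * G (L - 1 - l) ^ 4 := mul_pow _ _ _
      _ ≤ (1 + 3 * (l : ℕ)) * (1 + 3 * (L - 1 - l : ℕ)) :=
        mul_le_mul (prod_inv_one_sub_inv_pow_four_le _) (prod_inv_one_sub_inv_pow_four_le _)
          (by positivity) (by positivity)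
      _ ≤ (3 * L) ^ 2 := by
        rw [hL]
        nlinarith [mul_nonneg hl hr]
  rw [hprod]
  refine Real.le_sqrt_of_sq_le (abs_le_of_sq_le_sq' ?_ (by positivity)).2
  rwa [← pow_mul]

lemma sum_norm_coeff_padePolynomial_natNode_le {L : ℕ} (hL : 2 ≤ L) (M : ℕ) (j l : Fin L) :
    ∑ s ∈ Finset.range (M + 1), ‖((L - 1).factorial : ℚ) ^ M *
        (padePolynomial (natNode L) (padeExponent M j) l).coeff s‖ ≤
      2 * (2 ^ L * √(3 * L)) ^ M := by
  set n := padeExponent M j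
  set c := partialFractionCoeff (natNode L) n l
  have hterm (s : ℕ) : ‖((L - 1).factorial : ℚ) ^ M * (padePolynomial (natNode L) n l).coeff s‖ ≤
      ‖((L - 1).factorial : ℚ) ^ M * c s‖ := by
    have hfac : (1 : ℝ) ≤ s.factorial := by exact_mod_cast s.factorial_pos
    rw [coeff_padePolynomial, ← mul_div_assoc, norm_div, ← Rat.norm_cast_real (s.factorial : ℚ),
      Rat.cast_natCast, Real.norm_natCast]
    exact div_le_self (norm_nonneg _) hfac
  calc _ ≤ ∑ s ∈ Finset.range (M + 1), ‖((L - 1).factorial : ℚ) ^ M * c s‖ :=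
        Finset.sum_le_sum fun s _ => hterm s
    _ = ∑ s ∈ Finset.range (n l), ‖((L - 1).factorial : ℚ) ^ M * c s‖ := by
        refine (Finset.sum_subset (Finset.range_mono (padeExponent_le M j l)) fun s _ hs => ?_).symm
        have hzero : c s = 0 :=
          partialFractionCoeff_eq_zero _ (not_lt.1 fun h => hs (Finset.mem_range.2 h))
        rw [hzero, mul_zero, norm_zero]
    _ ≤ _ := sum_norm_pow_mul_partialFractionCoeff_le (natNode_injective L) (r := 1 / 4)
        (by norm_num) (by norm_num) (fun m hm => one_le_norm_natNode_sub hm) _ M j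
    _ ≤ (2 ^ (L - 2) * (1 / 4)⁻¹ * √(3 * L)) ^ M * 2 := by
        have hnonneg := prod_inv_one_sub_mul_norm_inv_nonneg (v := natNode L) (l := l)
          (by norm_num : (0 : ℝ) ≤ 1 / 4) (by norm_num) fun m hm => one_le_norm_natNode_sub hm
        have hweight := norm_factorial_mul_nodalWeight_natNode_le hL l
        have hgeom := prod_inv_one_sub_inv_norm_natNode_sub_le l
        exact mul_le_mul (pow_le_pow_left₀ (by positivity) (by gcongr) M) (by norm_num)
          (by norm_num) (by positivity)
    _ = 2 * (2 ^ L * √(3 * L)) ^ M := by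
        rw [show (2 : ℝ) ^ L = 2 ^ (L - 2) * (1 / 4)⁻¹ by
          rw [← Nat.sub_add_cancel hL, pow_add]; norm_num, mul_comm]

end NaturalNodes

section CoeffLength

variable {κ : Type*}

lemma coeffLength_nonneg (P : MvPolynomial κ ℤ) : 0 ≤ coeffLength P :=
  Finset.sum_nonneg fun _ _ => abs_nonneg _

lemma coeffLength_pos {P : MvPolynomial κ ℤ} (hP : P ≠ 0) : 0 < coeffLength P :=
  Finset.sum_pos
    (fun _ hm => abs_pos.2 (Int.cast_ne_zero.2 (MvPolynomial.mem_support_iff.1 hm)))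
    (MvPolynomial.support_nonempty.2 hP)

lemma coeffLength_zero : coeffLength (0 : MvPolynomial κ ℤ) = 0 := by
  rw [coeffLength, MvPolynomial.support_zero, Finset.sum_empty]

lemma coeffLength_eq_sum_of_support_subset {P : MvPolynomial κ ℤ} {s : Finset (κ →₀ ℕ)}
    (h : P.support ⊆ s) : coeffLength P = ∑ m ∈ s, |((P.coeff m : ℤ) : ℝ)| :=
  Finset.sum_subset h fun m _ hm => by
    rw [MvPolynomial.notMem_support_iff.1 hm, Int.cast_zero, abs_zero]

lemma coeffLength_monomial (m : κ →₀ ℕ) (a : ℤ) :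
    coeffLength (MvPolynomial.monomial m a) = |(a : ℝ)| := by
  classical
  rw [coeffLength_eq_sum_of_support_subset MvPolynomial.support_monomial_subset,
    Finset.sum_singleton, MvPolynomial.coeff_monomial, if_pos rfl]

lemma coeffLength_add_le (P Q : MvPolynomial κ ℤ) :
    coeffLength (P + Q) ≤ coeffLength P + coeffLength Q := by
  classical
  rw [coeffLength_eq_sum_of_support_subset MvPolynomial.support_add,
    coeffLength_eq_sum_of_support_subset (P := P) Finset.subset_union_left,
    coeffLength_eq_sum_of_support_subset (P := Q) Finset.subset_union_right,
    ← Finset.sum_add_distrib]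
  refine Finset.sum_le_sum fun m _ => ?_
  rw [MvPolynomial.coeff_add, Int.cast_add]
  exact abs_add_le _ _

lemma coeffLength_sum_le {ι : Type*} (s : Finset ι) (f : ι → MvPolynomial κ ℤ) :
    coeffLength (∑ i ∈ s, f i) ≤ ∑ i ∈ s, coeffLength (f i) :=
  Finset.le_sum_of_subadditive _ coeffLength_zero.le coeffLength_add_le s f

end CoeffLength

section BivariateForm

variable {L M : ℕ} {p : Fin L → ℤ[X]}

/-- The form `∑ l, p l * Y ^ l` in the two variables `X 0` (the variable of the `p l`) and
`X 1 = Y`. -/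
noncomputable def bivariateForm (p : Fin L → ℤ[X]) : MvPolynomial (Fin 2) ℤ :=
  ∑ l, aeval (MvPolynomial.X 0) (p l) * MvPolynomial.X 1 ^ (l : ℕ)

lemma aeval_bivariateForm {A : Type*} [CommRing A] [Algebra ℤ A] (p : Fin L → ℤ[X]) (x y : A) :
    MvPolynomial.aeval ![x, y] (bivariateForm p) = ∑ l, aeval x (p l) * y ^ (l : ℕ) := by
  simp only [bivariateForm, map_sum, map_mul, map_pow, ← aeval_algHom_apply, MvPolynomial.aeval_X,
    Matrix.cons_val_zero, Matrix.cons_val_one]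

lemma bivariateForm_eq_sum_monomial (hp : ∀ l, (p l).natDegree ≤ M) :
    bivariateForm p = ∑ l : Fin L, ∑ s ∈ Finset.range (M + 1), MvPolynomial.monomial
      (Finsupp.single 0 s + Finsupp.single 1 (l : ℕ)) ((p l).coeff s) := by
  refine Finset.sum_congr rfl fun l _ => ?_
  rw [aeval_eq_sum_range' (Nat.lt_succ_of_le (hp l)), Finset.sum_mul]
  refine Finset.sum_congr rfl fun s _ => ?_
  rw [MvPolynomial.X_pow_eq_monomial, MvPolynomial.X_pow_eq_monomial, smul_mul_assoc,
    MvPolynomial.monomial_mul, MvPolynomial.smul_monomial]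
  simp only [mul_one, smul_eq_mul]

lemma degreeOf_bivariateForm_le (hp : ∀ l, (p l).natDegree ≤ M) {i : Fin 2} {N : ℕ}
    (hN : ∀ s ≤ M, ∀ l : Fin L,
      (Finsupp.single 0 s + Finsupp.single 1 (l : ℕ) : Fin 2 →₀ ℕ) i ≤ N) :
    (bivariateForm p).degreeOf i ≤ N := by
  rw [bivariateForm_eq_sum_monomial hp]
  refine (MvPolynomial.degreeOf_sum_le ..).trans <| Finset.sup_le fun l _ =>
    (MvPolynomial.degreeOf_sum_le ..).trans <| Finset.sup_le fun s hs => ?_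
  refine MvPolynomial.degreeOf_le_iff.2 fun m hm => ?_
  rw [Finset.mem_singleton.1 (MvPolynomial.support_monomial_subset hm)]
  exact hN s (Nat.le_of_lt_succ (Finset.mem_range.1 hs)) l

lemma degreeOf_zero_bivariateForm_le (hp : ∀ l, (p l).natDegree ≤ M) :
    (bivariateForm p).degreeOf 0 ≤ M :=
  degreeOf_bivariateForm_le hp fun s hs l => by simpa using hs

lemma degreeOf_one_bivariateForm_le (hp : ∀ l, (p l).natDegree ≤ M) :
    (bivariateForm p).degreeOf 1 ≤ L - 1 :=
  degreeOf_bivariateForm_le hp fun s _ l => by simpa using Nat.le_sub_one_of_lt l.2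

lemma coeffLength_bivariateForm_le (hp : ∀ l, (p l).natDegree ≤ M) :
    coeffLength (bivariateForm p) ≤
      ∑ l, ∑ s ∈ Finset.range (M + 1), |(((p l).coeff s : ℤ) : ℝ)| := by
  rw [bivariateForm_eq_sum_monomial hp]
  refine (coeffLength_sum_le _ _).trans <| Finset.sum_le_sum fun l _ =>
    (coeffLength_sum_le _ _).trans_eq ?_
  simp only [coeffLength_monomial]

end BivariateForm

section IntegralForms

/-- A common denominator for the Hermite–Padé polynomials at the nodes `0, …, L - 1` with exponents
`padeExponent M j`. -/
def padeDenominator (M L : ℕ) : ℕ :=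
  lcmUpTo (L - 1) ^ M * largePrimePart (L - 1) M.factorial * (L - 1).factorial ^ M

/-- An upper bound for the length of the form obtained by clearing the denominators of the
Hermite–Padé polynomials at the nodes `0, …, L - 1`. -/
noncomputable def padeLengthBound (M L : ℕ) : ℝ :=
  lcmUpTo (L - 1) ^ M * factorialPart M (L - 1) * (L * (2 * (2 ^ L * √(3 * L)) ^ M))

lemma padeDenominator_pos (M L : ℕ) : 0 < padeDenominator M L :=
  Nat.mul_pos (Nat.mul_pos (pow_pos (lcmUpTo_pos _) _) (largePrimePart_pos _ _))
    (pow_pos (Nat.factorial_pos _) _)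

variable {L : ℕ}

lemma padeDenominator_mul_coeff_mem (M : ℕ) (j l : Fin L) (s : ℕ) :
    (padeDenominator M L : ℚ) * (padePolynomial (natNode L) (padeExponent M j) l).coeff s ∈
      (Int.castRingHom ℚ).range := by
  rw [padeDenominator]
  push_cast
  refine mul_coeff_padePolynomial_mem (natNode_injective L)
    (fun m hm => lcmUpTo_mul_inv_natNode_sub_mem hm)
    ⟨_, (factorial_mul_nodalWeight_natNode l).symm⟩ (fun t ht => ?_) j s
  obtain ⟨c, hc⟩ := factorial_dvd_lcmUpTo_pow_mul_largePrimePart (L - 1) ht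
  refine ⟨c, ?_⟩
  rw [eq_div_iff (by positivity), mul_comm, eq_intCast, Int.cast_natCast]
  exact_mod_cast hc.symm

lemma exists_map_eq_padeDenominator_smul (M : ℕ) (j l : Fin L) :
    ∃ p : ℤ[X], p.natDegree ≤ M ∧ p.map (Int.castRingHom ℚ) =
      (padeDenominator M L : ℚ) • padePolynomial (natNode L) (padeExponent M j) l := by
  obtain ⟨p, hp⟩ := (mem_lifts _).1 <| (lifts_iff_coeff_lifts (f := Int.castRingHom ℚ)
    ((padeDenominator M L : ℚ) • padePolynomial (natNode L) (padeExponent M j) l)).2 fun s => by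
      rw [coeff_smul, smul_eq_mul]
      exact padeDenominator_mul_coeff_mem M j l s
  refine ⟨p, ?_, hp⟩
  rw [← natDegree_map_eq_of_injective (Int.castRingHom ℚ).injective_int, hp]
  exact (natDegree_smul_le _ _).trans (natDegree_padePolynomial_le _ (padeExponent_le M j l))

variable {p : Fin L → ℤ[X]} {M : ℕ} {j : Fin L}

lemma X_pow_dvd_aeval_bivariateForm (A : Type*) [CommRing A] [Algebra ℚ A]
    (hp : ∀ l, (p l).map (Int.castRingHom ℚ) =
      (padeDenominator M L : ℚ) • padePolynomial (natNode L) (padeExponent M j) l) :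
    PowerSeries.X ^ (M * L) ∣
      MvPolynomial.aeval ![PowerSeries.X, PowerSeries.exp A] (bivariateForm p) := by
  have hdvd := X_pow_dvd_sum_padePolynomial_mul_exp (natNode_injective L) (padeExponent M j)
  rw [sum_padeExponent, Nat.add_sub_cancel, Fintype.card_fin] at hdvd
  have hform : MvPolynomial.aeval ![PowerSeries.X, PowerSeries.exp A] (bivariateForm p) =
      PowerSeries.map (algebraMap ℚ A) ((padeDenominator M L : ℚ) • ∑ l : Fin L,
        (padePolynomial (natNode L) (padeExponent M j) l : PowerSeries ℚ) *
          PowerSeries.rescale (natNode L l) (PowerSeries.exp ℚ)) := by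
    rw [aeval_bivariateForm, Finset.smul_sum, map_sum]
    refine Finset.sum_congr rfl fun l _ => ?_
    rw [← smul_mul_assoc, ← Polynomial.coe_smul, ← hp, map_mul, natNode,
      ← PowerSeries.exp_pow_eq_rescale_exp, map_pow, PowerSeries.map_exp, polynomial_map_coe]
    congr 1
    have hX := aeval_algHom_apply (coeToPowerSeries.algHom (R := ℤ) A) X (p l)
    rw [aeval_X_left_apply, coeToPowerSeries.algHom_apply, coeToPowerSeries.algHom_apply,
      coe_X, PowerSeries.map_X] at hX
    rw [hX, ← polynomial_map_coe, ← polynomial_map_coe, ← polynomial_map_coe, Polynomial.map_map]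
    congr 2
    exact RingHom.ext_int _ _
  rw [hform, ← PowerSeries.map_X (algebraMap ℚ A), ← map_pow]
  exact map_dvd _ (dvd_smul_of_dvd _ hdvd)

lemma coeffLength_bivariateForm_le_padeLengthBound (hL : 2 ≤ L) (hdeg : ∀ l, (p l).natDegree ≤ M)
    (hp : ∀ l, (p l).map (Int.castRingHom ℚ) =
      (padeDenominator M L : ℚ) • padePolynomial (natNode L) (padeExponent M j) l) :
    coeffLength (bivariateForm p) ≤ padeLengthBound M L := by
  have hcoeff (l : Fin L) (s : ℕ) : |(((p l).coeff s : ℤ) : ℝ)| =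
      (lcmUpTo (L - 1) ^ M * factorialPart M (L - 1)) * ‖((L - 1).factorial : ℚ) ^ M *
        (padePolynomial (natNode L) (padeExponent M j) l).coeff s‖ := by
    have h := congrArg (fun q : ℚ[X] => ‖q.coeff s‖) (hp l)
    simp only [coeff_map, coeff_smul, eq_intCast, smul_eq_mul, Int.norm_cast_rat,
      Int.norm_eq_abs] at h
    rw [h, padeDenominator, factorialPart_eq_largePrimePart, Nat.cast_mul, mul_assoc, norm_mul,
      ← Rat.norm_cast_real (Nat.cast _), Rat.cast_natCast, Real.norm_natCast, Nat.cast_mul,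
      Nat.cast_pow, Nat.cast_pow]
  refine (coeffLength_bivariateForm_le hdeg).trans ?_
  simp only [hcoeff, ← Finset.mul_sum]
  refine mul_le_mul_of_nonneg_left ((Finset.sum_le_sum fun l _ =>
    sum_norm_coeff_padePolynomial_natNode_le hL M j l).trans_eq ?_) ?_
  · rw [Finset.sum_const, Finset.card_univ, Fintype.card_fin, nsmul_eq_mul]
  · rw [factorialPart_eq_largePrimePart]
    positivity

lemma aeval_bivariateForm_eq_padeDenominator_mul {A : Type*} [CommRing A] [Algebra ℚ A] (x y : A)
    (hp : ∀ l, (p l).map (Int.castRingHom ℚ) =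
      (padeDenominator M L : ℚ) • padePolynomial (natNode L) (padeExponent M j) l) :
    MvPolynomial.aeval ![x, y] (bivariateForm p) = padeDenominator M L *
      ∑ l : Fin L, aeval x (padePolynomial (natNode L) (padeExponent M j) l) * y ^ (l : ℕ) := by
  rw [aeval_bivariateForm, Finset.mul_sum]
  refine Finset.sum_congr rfl fun l _ => ?_
  have heval : aeval x (p l) = aeval x ((p l).map (algebraMap ℤ ℚ)) :=
    (aeval_map_algebraMap ..).symm
  rw [heval, algebraMap_int_eq, hp, map_smul, Algebra.smul_def, map_natCast, mul_assoc]

theorem exists_integral_form (hL : 2 ≤ L) (M : ℕ) {α β : ℂ} (hβ : β ≠ 0) :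
    ∃ P : MvPolynomial (Fin 2) ℤ, P.degreeOf 0 ≤ M ∧ P.degreeOf 1 ≤ L - 1 ∧
      coeffLength P ≤ padeLengthBound M L ∧
      PowerSeries.X ^ (M * L) ∣ MvPolynomial.aeval ![PowerSeries.X, PowerSeries.exp ℂ] P ∧
      MvPolynomial.aeval ![β, α] P ≠ 0 := by
  have : NeZero L := ⟨by omega⟩
  have hw : (fun l : Fin L => α ^ (l : ℕ)) ≠ 0 := fun h => by simpa using congrFun h 0
  obtain ⟨j, hj⟩ := exists_sum_aeval_padePolynomial_mul_ne_zero (natNode_injective L) M hβ hw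
  choose p hdeg hp using exists_map_eq_padeDenominator_smul M j
  refine ⟨bivariateForm p, degreeOf_zero_bivariateForm_le hdeg, degreeOf_one_bivariateForm_le hdeg,
    coeffLength_bivariateForm_le_padeLengthBound hL hdeg hp, X_pow_dvd_aeval_bivariateForm ℂ hp, ?_⟩
  rw [aeval_bivariateForm_eq_padeDenominator_mul β α hp]
  exact mul_ne_zero (Nat.cast_ne_zero.2 (padeDenominator_pos M L).ne') hj

end IntegralForms

section PolynomialsInPowerSeries

lemma aeval_eq_sum_zsmul {κ A : Type*} [Fintype κ] [CommRing A] [Algebra ℤ A] (x : κ → A)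
    (P : MvPolynomial κ ℤ) :
    MvPolynomial.aeval x P = ∑ m ∈ P.support, P.coeff m • ∏ i, x i ^ m i := by
  rw [MvPolynomial.aeval_def, MvPolynomial.eval₂_eq']
  simp only [zsmul_eq_mul, eq_intCast]

namespace HasWeightedBound

variable {R : Type*} [NormedCommRing R] {f : PowerSeries R} {r B : ℝ}

protected lemma sum {ι : Type*} {s : Finset ι} {f : ι → PowerSeries R} {A : ι → ℝ}
    (hr : 0 ≤ r) (h : ∀ i ∈ s, HasWeightedBound r (f i) (A i)) :
    HasWeightedBound r (∑ i ∈ s, f i) (∑ i ∈ s, A i) := by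
  intro N
  calc ∑ k ∈ Finset.range N, ‖PowerSeries.coeff k (∑ i ∈ s, f i)‖ * r ^ k
      ≤ ∑ k ∈ Finset.range N, ∑ i ∈ s, ‖PowerSeries.coeff k (f i)‖ * r ^ k := by
        refine Finset.sum_le_sum fun k _ => ?_
        rw [map_sum, ← Finset.sum_mul]
        exact mul_le_mul_of_nonneg_right (norm_sum_le _ _) (pow_nonneg hr k)
    _ = ∑ i ∈ s, ∑ k ∈ Finset.range N, ‖PowerSeries.coeff k (f i)‖ * r ^ k := Finset.sum_comm
    _ ≤ ∑ i ∈ s, A i := Finset.sum_le_sum fun i hi => h i hi N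

protected lemma zsmul (hr : 0 ≤ r) (hf : HasWeightedBound r f B) (a : ℤ) :
    HasWeightedBound r (a • f) (|(a : ℝ)| * B) := by
  intro N
  refine le_trans ?_ (mul_le_mul_of_nonneg_left (hf N) (abs_nonneg (a : ℝ)))
  rw [Finset.mul_sum]
  refine Finset.sum_le_sum fun k _ => ?_
  rw [← mul_assoc, map_zsmul, ← Int.norm_eq_abs]
  exact mul_le_mul_of_nonneg_right (norm_zsmul_le _ _) (pow_nonneg hr k)

protected lemma X [NormOneClass R] (hr : 0 ≤ r) :
    HasWeightedBound r (PowerSeries.X : PowerSeries R) r := by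
  intro N
  simp only [PowerSeries.coeff_X, apply_ite norm, norm_one, norm_zero, ite_mul, one_mul, zero_mul,
    Finset.sum_ite_eq', pow_one]
  split_ifs
  exacts [le_rfl, hr]

protected lemma exp {𝕜 : Type*} [RCLike 𝕜] (hr : 0 ≤ r) :
    HasWeightedBound r (PowerSeries.exp 𝕜) (Real.exp r) := by
  intro N
  refine le_trans (Finset.sum_le_sum fun k _ => ?_) (Real.sum_le_exp_of_nonneg hr N)
  rw [PowerSeries.coeff_exp, map_div₀, map_one, map_natCast, norm_div, norm_one,
    RCLike.norm_natCast, one_div_mul_eq_div]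

protected lemma aeval [NormOneClass R] {κ : Type*} [Fintype κ] [Algebra ℤ (PowerSeries R)]
    {f : κ → PowerSeries R} {A : κ → ℝ} (hr : 0 ≤ r) (hf : ∀ i, HasWeightedBound r (f i) (A i))
    {P : MvPolynomial κ ℤ} {T : ℝ} (hT : ∀ m ∈ P.support, ∏ i, A i ^ m i ≤ T) :
    HasWeightedBound r (MvPolynomial.aeval f P) (coeffLength P * T) := by
  rw [aeval_eq_sum_zsmul, coeffLength, Finset.sum_mul]
  exact HasWeightedBound.sum hr fun m hm =>
    ((HasWeightedBound.prod hr fun i _ => (hf i).pow hr (m i)).mono (hT m hm)).zsmul hr _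

lemma norm_hasSum_le_of_X_pow_dvd [NormOneClass R] {N : ℕ} {E : ℝ} (hE : 1 ≤ E) {z F : R}
    (hf : HasWeightedBound (E * ‖z‖) f B) (hdvd : PowerSeries.X ^ N ∣ f)
    (hF : HasSum (fun i => PowerSeries.coeff i f * z ^ i) F) :
    ‖F‖ ≤ (E ^ N)⁻¹ * B := by
  have : 0 < E := by linarith
  have hterm (i : ℕ) : ‖PowerSeries.coeff i f * z ^ i‖ ≤
      (E ^ N)⁻¹ * (‖PowerSeries.coeff i f‖ * (E * ‖z‖) ^ i) := by
    by_cases hi : i < N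
    · rw [PowerSeries.X_pow_dvd_iff.1 hdvd i hi]
      simpa only [zero_mul, norm_zero, mul_zero] using le_rfl
    · have hpow : ‖z‖ ^ i ≤ (E ^ N)⁻¹ * (E * ‖z‖) ^ i := by
        rw [mul_pow, ← mul_assoc]
        refine le_mul_of_one_le_left (by positivity) ?_
        rw [inv_mul_eq_div, one_le_div (by positivity)]
        exact pow_le_pow_right₀ hE (not_lt.1 hi)
      calc ‖PowerSeries.coeff i f * z ^ i‖ ≤ ‖PowerSeries.coeff i f‖ * ‖z‖ ^ i :=
            (norm_mul_le _ _).trans (mul_le_mul_of_nonneg_left (norm_pow_le z i) (norm_nonneg _))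
        _ ≤ ‖PowerSeries.coeff i f‖ * ((E ^ N)⁻¹ * (E * ‖z‖) ^ i) := by gcongr
        _ = (E ^ N)⁻¹ * (‖PowerSeries.coeff i f‖ * (E * ‖z‖) ^ i) := by ring
  refine le_of_tendsto' hF.tendsto_sum_nat.norm fun n => ?_
  refine (norm_sum_le_of_le _ fun i _ => hterm i).trans ?_
  rw [← Finset.mul_sum]
  exact mul_le_mul_of_nonneg_left (hf n) (by positivity)

end HasWeightedBound

variable {𝕜 : Type*} [RCLike 𝕜]

lemma hasSum_coeff_X_pow_mul {f : PowerSeries 𝕜} {z F : 𝕜}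
    (hF : HasSum (fun i => PowerSeries.coeff i f * z ^ i) F) (a : ℕ) :
    HasSum (fun i => PowerSeries.coeff i (PowerSeries.X ^ a * f) * z ^ i) (z ^ a * F) := by
  rw [← hasSum_nat_add_iff' a]
  have hzero : ∑ i ∈ Finset.range a, PowerSeries.coeff i (PowerSeries.X ^ a * f) * z ^ i = 0 :=
    Finset.sum_eq_zero fun i hi => by
      rw [PowerSeries.coeff_X_pow_mul', if_neg (not_le.2 (Finset.mem_range.1 hi)), zero_mul]
  rw [hzero, sub_zero]
  refine (hF.mul_left (z ^ a)).congr_fun fun i => ?_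
  rw [PowerSeries.coeff_X_pow_mul, pow_add]
  ring

lemma hasSum_coeff_exp_pow (b : ℕ) (z : 𝕜) :
    HasSum (fun i => PowerSeries.coeff i (PowerSeries.exp 𝕜 ^ b) * z ^ i)
      (NormedSpace.exp z ^ b) := by
  rw [← NormedSpace.exp_nsmul, nsmul_eq_mul]
  refine (NormedSpace.expSeries_div_hasSum_exp ((b : 𝕜) * z)).congr_fun fun i => ?_
  rw [PowerSeries.exp_pow_eq_rescale_exp, PowerSeries.coeff_rescale, PowerSeries.coeff_exp,
    map_div₀, map_one, map_natCast]
  ring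

lemma hasSum_coeff_aeval_X_exp [Algebra ℤ (PowerSeries 𝕜)] (P : MvPolynomial (Fin 2) ℤ) (z : 𝕜) :
    HasSum (fun i => PowerSeries.coeff i
        (MvPolynomial.aeval ![PowerSeries.X, PowerSeries.exp 𝕜] P) * z ^ i)
      (MvPolynomial.aeval ![z, NormedSpace.exp z] P) := by
  simp only [aeval_eq_sum_zsmul, Fin.prod_univ_two, Matrix.cons_val_zero, Matrix.cons_val_one,
    map_sum, map_zsmul, Finset.sum_mul, smul_mul_assoc]
  exact hasSum_sum fun m _ =>
    (hasSum_coeff_X_pow_mul (hasSum_coeff_exp_pow (m 1) z) (m 0)).const_smul _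

end PolynomialsInPowerSeries

section UpperBound

lemma norm_pow_sub_pow_le_mul {R : Type*} [NormedCommRing R] [NormOneClass R] {x y : R} {C : ℝ}
    (hC : 1 ≤ C) (hx : ‖x‖ ≤ C) (hy : ‖y‖ ≤ C) (n : ℕ) :
    ‖x ^ n - y ^ n‖ ≤ n * C ^ n * ‖x - y‖ := by
  have hterm (i : ℕ) (hi : i ∈ Finset.range n) : ‖x ^ i * y ^ (n - 1 - i)‖ ≤ C ^ n := by
    have hin := Finset.mem_range.1 hi
    calc ‖x ^ i * y ^ (n - 1 - i)‖ ≤ ‖x‖ ^ i * ‖y‖ ^ (n - 1 - i) :=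
          (norm_mul_le _ _).trans (by gcongr <;> exact norm_pow_le _ _)
      _ ≤ C ^ i * C ^ (n - 1 - i) := by gcongr
      _ = C ^ (n - 1) := by rw [← pow_add, Nat.add_sub_cancel' (by omega)]
      _ ≤ C ^ n := pow_le_pow_right₀ hC (Nat.sub_le _ _)
  rw [← (Commute.all x y).geom_sum₂_mul]
  refine (norm_mul_le _ _).trans (mul_le_mul_of_nonneg_right ?_ (norm_nonneg _))
  simpa using norm_sum_le_of_le _ hterm

lemma pow_mul_exp_pow_le {x : ℝ} (hx : 0 ≤ x) {s n M N : ℕ} (hs : s ≤ M) (hn : n ≤ N) :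
    x ^ s * Real.exp x ^ n ≤ M.factorial * Real.exp ((N + 1) * x) := by
  have hpow : x ^ s ≤ s.factorial * Real.exp x := by
    have h := Real.pow_div_factorial_le_exp x hx s
    rwa [div_le_iff₀' (by positivity)] at h
  calc x ^ s * Real.exp x ^ n ≤ (s.factorial * Real.exp x) * Real.exp x ^ n := by gcongr
    _ = s.factorial * Real.exp x ^ (n + 1) := by ring
    _ ≤ M.factorial * Real.exp x ^ (N + 1) := by
        gcongr
        exact Real.one_le_exp hx
    _ = M.factorial * Real.exp ((N + 1) * x) := by
        rw [← Real.exp_nat_mul, Nat.cast_add_one]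

variable {P : MvPolynomial (Fin 2) ℤ} {M N : ℕ}

lemma norm_aeval_sub_aeval_le {x y z : ℂ} {T : ℝ} (hM : P.degreeOf 0 ≤ M) (hN : P.degreeOf 1 ≤ N)
    (hT : ∀ s ≤ M, ∀ n ≤ N, ‖x‖ ^ s * ‖y ^ n - z ^ n‖ ≤ T) :
    ‖MvPolynomial.aeval ![x, y] P - MvPolynomial.aeval ![x, z] P‖ ≤ coeffLength P * T := by
  rw [aeval_eq_sum_zsmul, aeval_eq_sum_zsmul, ← Finset.sum_sub_distrib, coeffLength, Finset.sum_mul]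
  refine norm_sum_le_of_le _ fun m hm => ?_
  rw [← zsmul_sub, Fin.prod_univ_two, Fin.prod_univ_two]
  simp only [Matrix.cons_val_zero, Matrix.cons_val_one]
  rw [← mul_sub, zsmul_eq_mul, norm_mul, norm_mul, norm_pow, Complex.norm_intCast]
  exact mul_le_mul_of_nonneg_left (hT _ ((MvPolynomial.monomial_le_degreeOf 0 hm).trans hM) _
    ((MvPolynomial.monomial_le_degreeOf 1 hm).trans hN)) (abs_nonneg _)

variable {α β : ℂ} {V : ℕ} {E : ℝ}

lemma norm_aeval_exp_le_of_X_pow_dvd (hM : P.degreeOf 0 ≤ M) (hN : P.degreeOf 1 ≤ N) (hE : 1 ≤ E)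
    (hP : PowerSeries.X ^ V ∣ MvPolynomial.aeval ![PowerSeries.X, PowerSeries.exp ℂ] P) :
    ‖MvPolynomial.aeval ![β, Complex.exp β] P‖ ≤
      (E ^ V)⁻¹ * (coeffLength P * (M.factorial * Real.exp ((N + 1) * (E * ‖β‖)))) := by
  have hr : 0 ≤ E * ‖β‖ := by positivity
  have hbound : HasWeightedBound (E * ‖β‖)
      (MvPolynomial.aeval ![PowerSeries.X, PowerSeries.exp ℂ] P)
      (coeffLength P * (M.factorial * Real.exp ((N + 1) * (E * ‖β‖)))) := by
    have hgen : ∀ i, HasWeightedBound (E * ‖β‖)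
        (![PowerSeries.X, PowerSeries.exp ℂ] i) (![E * ‖β‖, Real.exp (E * ‖β‖)] i) :=
      Fin.forall_fin_two.2 ⟨.X hr, .exp hr⟩
    refine HasWeightedBound.aeval hr hgen fun m hm => ?_
    rw [Fin.prod_univ_two]
    exact pow_mul_exp_pow_le hr ((MvPolynomial.monomial_le_degreeOf 0 hm).trans hM)
      ((MvPolynomial.monomial_le_degreeOf 1 hm).trans hN)
  rw [Complex.exp_eq_exp_ℂ]
  exact hbound.norm_hasSum_le_of_X_pow_dvd hE hP (hasSum_coeff_aeval_X_exp P β)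

lemma pow_mul_norm_exp_pow_sub_pow_le {δ : ℝ} (hδ : δ ≤ 1) (hα : ‖Complex.exp β - α‖ ≤ δ)
    {s n : ℕ} (hs : s ≤ M) (hn : n ≤ N) :
    ‖β‖ ^ s * ‖Complex.exp β ^ n - α ^ n‖ ≤
      δ * (M.factorial * Real.exp ((N + 1) * ‖β‖)) * (N * 2 ^ N) := by
  have hexp : ‖Complex.exp β‖ ≤ Real.exp ‖β‖ := Complex.norm_exp_le_exp_norm β
  have hone : 1 ≤ Real.exp ‖β‖ := Real.one_le_exp (norm_nonneg β)
  have hαexp : ‖α‖ ≤ 2 * Real.exp ‖β‖ := by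
    linarith [norm_le_norm_add_norm_sub (Complex.exp β) α]
  have hδ0 : 0 ≤ δ := (norm_nonneg _).trans hα
  calc ‖β‖ ^ s * ‖Complex.exp β ^ n - α ^ n‖
      ≤ ‖β‖ ^ s * (n * (2 * Real.exp ‖β‖) ^ n * δ) := by
        gcongr
        refine (norm_pow_sub_pow_le_mul (C := 2 * Real.exp ‖β‖) (by linarith) (by linarith) hαexp
          n).trans ?_
        gcongr
    _ = δ * (‖β‖ ^ s * Real.exp ‖β‖ ^ n) * (n * 2 ^ n) := by ring
    _ ≤ δ * (M.factorial * Real.exp ((N + 1) * ‖β‖)) * (N * 2 ^ N) := by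
        have := pow_mul_exp_pow_le (norm_nonneg β) hs hn
        gcongr
        exact one_le_two

theorem norm_aeval_le_of_norm_exp_sub_le (hM : P.degreeOf 0 ≤ M) (hN : P.degreeOf 1 ≤ N)
    (hE : 1 ≤ E)
    (hP : PowerSeries.X ^ V ∣ MvPolynomial.aeval ![PowerSeries.X, PowerSeries.exp ℂ] P)
    (hα : ‖Complex.exp β - α‖ ≤ (E ^ V)⁻¹) :
    ‖MvPolynomial.aeval ![β, α] P‖ ≤ (E ^ V)⁻¹ * coeffLength P * M.factorial *
      Real.exp ((N + 1) * (E * ‖β‖)) * ((N + 1) * 2 ^ N) := by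
  set T := (M.factorial : ℝ) * Real.exp ((N + 1) * (E * ‖β‖)) with hT
  have hH := coeffLength_nonneg P
  have : 0 < E := by linarith
  have hβE : ‖β‖ ≤ E * ‖β‖ := le_mul_of_one_le_left (norm_nonneg _) hE
  have hexp := norm_aeval_exp_le_of_X_pow_dvd (β := β) hM hN hE hP
  have hdiff : ‖MvPolynomial.aeval ![β, Complex.exp β] P - MvPolynomial.aeval ![β, α] P‖ ≤
      coeffLength P * ((E ^ V)⁻¹ * T * (N * 2 ^ N)) := by
    refine norm_aeval_sub_aeval_le hM hN fun s hs n hn =>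
      (pow_mul_norm_exp_pow_sub_pow_le (inv_le_one_of_one_le₀ (one_le_pow₀ hE)) hα hs hn).trans ?_
    rw [hT]
    gcongr
  have htwo : (1 : ℝ) ≤ 2 ^ N := one_le_pow₀ one_le_two
  calc ‖MvPolynomial.aeval ![β, α] P‖
      ≤ (E ^ V)⁻¹ * (coeffLength P * T) + coeffLength P * ((E ^ V)⁻¹ * T * (N * 2 ^ N)) :=
        (norm_le_norm_add_norm_sub _ _).trans (add_le_add hexp hdiff)
    _ = (E ^ V)⁻¹ * coeffLength P * T * (1 + N * 2 ^ N) := by ring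
    _ ≤ (E ^ V)⁻¹ * coeffLength P * T * ((N + 1) * 2 ^ N) := by
        refine mul_le_mul_of_nonneg_left ?_ (by positivity)
        linarith
    _ = _ := by rw [hT]; ring

end UpperBound

section LowerBound

lemma log_padeLengthBound (M : ℕ) {L : ℕ} (hL : L ≠ 0) :
    Real.log (padeLengthBound M L) = M * Real.log (lcmUpTo (L - 1)) +
      Real.log (factorialPart M (L - 1)) + Real.log L + Real.log 2 +
      M * (L * Real.log 2 + Real.log √(3 * L)) := by
  have hd := (lcmUpTo_pos (L - 1)).ne'
  have hF : factorialPart M (L - 1) ≠ 0 := by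
    rw [factorialPart_eq_largePrimePart]
    exact Nat.cast_ne_zero.2 (largePrimePart_pos _ _).ne'
  rw [padeLengthBound, Real.log_mul (by positivity) (by positivity),
    Real.log_mul (by positivity) hF, Real.log_mul (by positivity) (by positivity),
    Real.log_mul (by positivity) (by positivity), Real.log_pow, Real.log_pow,
    Real.log_mul (by positivity) (by positivity), Real.log_pow]
  ring

variable {α β : ℂ} {E : ℝ} {L : ℕ}

theorem mul_log_le_of_norm_exp_sub_le (hα : IsAlgebraic ℚ α) (hβ : IsAlgebraic ℚ β) (hβ0 : β ≠ 0)
    (hL : 2 ≤ L) (M : ℕ) (hE : 1 ≤ E) (hclose : ‖Complex.exp β - α‖ ≤ (E ^ (M * L))⁻¹) :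
    M * L * Real.log E ≤ degreeRatio α β * Real.log (padeLengthBound M L) +
      Real.log M.factorial + L * E * ‖β‖ + Real.log L + (L - 1) * Real.log 2 +
      M * (degreeRatio α β * weilHeight β - Real.log (max 1 ‖β‖)) +
      (L - 1) * (degreeRatio α β * weilHeight α - Real.log (max 1 ‖α‖)) := by
  obtain ⟨P, hM, hN, hH, hvanish, hne⟩ := exists_integral_form (α := α) hL M hβ0
  have hlength : 0 < coeffLength P := coeffLength_pos fun h => hne (by rw [h, map_zero])
  have : (0 : ℝ) < L := by positivity
  have hpred : ((L - 1 : ℕ) : ℝ) + 1 = L := by exact_mod_cast Nat.sub_add_cancel (by omega)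
  have hupper := Real.log_le_log (norm_pos_iff.2 hne)
    (norm_aeval_le_of_norm_exp_sub_le hM hN hE hvanish hclose)
  rw [hpred, Real.log_mul (by positivity) (by positivity),
    Real.log_mul (by positivity) (by positivity), Real.log_mul (by positivity) (by positivity),
    Real.log_mul (by positivity) (by positivity), Real.log_mul (by positivity) (by positivity),
    Real.log_inv, Real.log_exp, Real.log_pow, Real.log_pow, Nat.cast_mul] at hupper
  have hlower := liouville_inequality_degreeRatio hα hβ hM hN hne
  have hD : 0 ≤ degreeRatio α β := zero_le_one.trans (one_le_degreeRatio hα hβ)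
  have hlog := mul_le_mul_of_nonneg_left (Real.log_le_log hlength hH) hD
  rw [← eq_sub_iff_add_eq] at hpred
  rw [hpred] at hupper hlower
  linarith

lemma log_natCast_le_sub_one_mul_log_two (hL : L ≠ 0) :
    Real.log L ≤ (L - 1) * Real.log 2 := by
  have hpow : (L : ℝ) ≤ 2 ^ (L - 1) := by
    exact_mod_cast (by have := Nat.lt_two_pow_self (n := L - 1); omega : L ≤ 2 ^ (L - 1))
  have h := Real.log_le_log (by positivity) hpow
  rwa [Real.log_pow, Nat.cast_pred (Nat.pos_of_ne_zero hL)] at h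

lemma sub_one_mul_le_log_pow_mul {a : ℝ} (ha : 1 ≤ a) (hL : L ≠ 0) :
    (L - 1) * (2 * Real.log 2 + 1) ≤ Real.log ((4 * Real.exp 1) ^ (L - 1) * a) := by
  rw [Real.log_mul (by positivity) (by positivity), Real.log_pow,
    Real.log_mul (by norm_num) (by positivity), Real.log_exp,
    show (4 : ℝ) = 2 ^ 2 by norm_num, Real.log_pow, Nat.cast_pred (Nat.pos_of_ne_zero hL)]
  exact le_add_of_nonneg_right (Real.log_nonneg ha)

lemma one_le_min_lcmUpTo_pow_factorial (M n : ℕ) :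
    (1 : ℝ) ≤ min ((lcmUpTo n : ℝ) ^ M) (n.factorial : ℝ) :=
  le_min (one_le_pow₀ (by exact_mod_cast lcmUpTo_pos n)) (by exact_mod_cast n.factorial_pos)

lemma add_mul_log_two_lt_mul {D : ℝ} (hD : 1 ≤ D) (hL : 2 ≤ L) (M : ℕ) {a : ℝ} (ha : 1 ≤ a) :
    (M + 2 * (L - 1)) * Real.log 2 + Real.log L <
      D * (L * Real.log 2 + M + Real.log ((4 * Real.exp 1) ^ (L - 1) * a) - Real.log L -
        Real.log 2) := by
  set bracket := L * Real.log 2 + M + Real.log ((4 * Real.exp 1) ^ (L - 1) * a) - Real.log L -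
    Real.log 2
  have hlogL := log_natCast_le_sub_one_mul_log_two (L := L) (by omega)
  have hlogpow := sub_one_mul_le_log_pow_mul (L := L) ha (by omega)
  have hbracket : M + (L - 1) * (2 * Real.log 2 + 1) ≤ bracket := by
    linarith
  have hL1 : (0 : ℝ) < L - 1 := sub_pos.2 (Nat.one_lt_cast.2 hL)
  have hlog2 : 0 < Real.log 2 := Real.log_pos one_lt_two
  calc (M + 2 * (L - 1)) * Real.log 2 + Real.log L
      ≤ (M + (L - 1)) * Real.log 2 + (L - 1) * (2 * Real.log 2) := by linarith
    _ < (M + (L - 1)) * 1 + (L - 1) * (2 * Real.log 2) := by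
        gcongr
        linarith [Real.log_two_lt_d9]
    _ = M + (L - 1) * (2 * Real.log 2 + 1) := by ring
    _ ≤ bracket := hbracket
    _ ≤ D * bracket := le_mul_of_one_le_left (hbracket.trans' (by positivity)) hD

end LowerBound

theorem mainTheorem1 (α β : ℂ) (hα : IsAlgebraic ℚ α) (hβ : IsAlgebraic ℚ β) (hβ0 : β ≠ 0)
    (A B : ℝ) (hA : 1 ≤ A) (hB : 1 ≤ B)
    (hαA : degreeRatio α β * weilHeight α - Real.log (max 1 ‖α‖) ≤ Real.log A)
    (hβB : degreeRatio α β * weilHeight β - Real.log (max 1 ‖β‖) ≤ Real.log B)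
    (K L : ℕ) (hK : 1 ≤ K) (hL : 2 ≤ L) (E : ℝ) (hE : 1 < E)
    (hineq :
      degreeRatio α β * K * L * Real.log 2
        + degreeRatio α β * ((K : ℝ) - 1)
            * Real.log (Real.exp 1 * √(3 * (L : ℝ)) * (lcmUpTo (L - 1) : ℝ))
        + degreeRatio α β * Real.log (factorialPart (K - 1) (L - 1))
        + degreeRatio α β
            * Real.log ((4 * Real.exp 1) ^ (L - 1)
                * min ((lcmUpTo (L - 2) : ℝ) ^ (K - 1)) ((L - 2).factorial : ℝ))
        + Real.log ((K - 1).factorial : ℝ)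
        + ((K : ℝ) - 1) * Real.log (B / 2)
        + ((L : ℝ) - 1) * Real.log (A / 2)
        + L * E * ‖β‖
        + L * Real.log E
      ≤ K * L * Real.log E) :
    E ^ (-((K : ℤ) * (L : ℤ))) ≤ ‖Complex.exp β - α‖ := by
  by_contra! hlt
  obtain ⟨M, rfl⟩ : ∃ M, K = M + 1 := ⟨K - 1, by omega⟩
  have hclose : ‖Complex.exp β - α‖ ≤ (E ^ (M * L))⁻¹ := by
    refine hlt.le.trans ?_
    rw [← Nat.cast_mul, zpow_neg, zpow_natCast]
    gcongr
    exacts [hE.le, Nat.le_succ M]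
  have hupper := mul_log_le_of_norm_exp_sub_le hα hβ hβ0 hL M hE.le hclose
  have hslack := add_mul_log_two_lt_mul (one_le_degreeRatio hα hβ) hL M
    (one_le_min_lcmUpTo_pow_factorial M (L - 2))
  have hd := lcmUpTo_pos (L - 1)
  rw [log_padeLengthBound M (by omega)] at hupper
  rw [Nat.add_sub_cancel, Real.log_mul (by positivity) (by positivity),
    Real.log_mul (by positivity) (by positivity), Real.log_exp,
    Real.log_div (by positivity) two_ne_zero, Real.log_div (by positivity) two_ne_zero,
    Nat.cast_add_one, add_sub_cancel_right] at hineq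
  have hβ' := mul_le_mul_of_nonneg_left hβB M.cast_nonneg
  have hα' := mul_le_mul_of_nonneg_left hαA (sub_nonneg.2 (Nat.one_le_cast.2 (by omega : 1 ≤ L)))
  linarith
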